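/- Let $n\ge 1$, write $[n]=\{1,\dots,n\}$, and let $\lambda=(\lambda_1\ge\dots\ge\lambda_n\ge 0)$ be a partition with $n$ nonnegative integer parts. Let $R_\lambda=\{q_1<\dots<q_r\}\subseteq[n-1]$ be the set of distinct column lengths of the shape $\lambda$ that are less than $n$, and put $q_0=0$, $q_{r+1}=n$. The intervals $\{q_{h-1}+1,\dots,q_h\}$, $1\le h\le r+1$, are called carrels. *Tuples.* An upper tuple is $\beta\in[n]^n$ with $\beta_i\ge i$ for all $i$. Its critical indices in the $h$-th carrel are found from right to left: $q_h$ is critical, and the next critical index to the left of a critical index $x$ is the largest $y<x$ in the same carrel with $\beta_x-\beta_y>x-y$, if it exists. The tuple $\beta$ is a gapless core tuple if for all $1\le h\le r$ one has $\beta_{q_h}\le\beta_k$, where $k$ is the leftmost critical index of the $(h+1)$-st carrel. It is bounded by its platform if $\beta_i\le\beta_x$ for all $i$, where $x$ is the smallest critical index with $x\ge i$. *Polynomials.* Let $s_\lambda(\beta;x)=\sum_T x^{\Theta(T)}$, the sum over the semistandard tableaux $T$ of shape $\lambda$ with values in $[n]$ whose values in row $i$ are at most $\beta_i$ for all $i$,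 where $x^{\Theta(T)}$ is the product of $x_v$ over the values $v$ of $T$. Let $h_u(i,k;x)$ be the complete homogeneous symmetric polynomial of degree $u$ in $x_i,x_{i+1},\dots,x_k$, with $h_u=0$ for $u<0$. The Gessel–Viennot determinant with input $\beta$ is the $n\times n$ determinant $\bigl|h_{\lambda_j-j+i}(i,\beta_j;x)\bigr|$. *Valid inputs.* Consider lattice paths with unit steps $(1,0)$ and $(0,1)$. An upper tuple $\beta$ is a valid input if $(\lambda,\beta)$ is nonpermutable, i.e. if for no permutation $\pi\ne\mathrm{id}$ of $[n]$ are there pairwise disjoint lattice paths $\Lambda_1,\dots,\Lambda_n$ such that $\Lambda_m$ runs from $(n-m,m)$ to $(\lambda_{\pi_m}+n-\pi_m,\beta_{\pi_m})$ for every $m\in[n]$. *Efficiency.* A gapless core tuple $\eta$ that is bounded by its platform attains maximum efficiency if the total number of monomials in the entries of $\bigl|h_{\lambda_j-j+i}(i,\eta_j;x)\bigr|$ is strictly smaller than the corresponding number for every other gapless core tuple $\eta'\neq\eta$ that is bounded by its platform and whose Gessel–Viennot determinant equals $s_\lambda(\eta;x)$. *Parabolic Catalan number.* $C_n^\lambda$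 is the number of $\lambda$-312-avoiding permutations, i.e. of permutations $\pi$ of $[n]$ that are increasing on each carrel and for which there are no $q<q'$ in $R_\lambda$ and indices $a\le q<b\le q'<c$ with $\pi_b<\pi_c<\pi_a$. **Statement.** The number of valid inputs that attain maximum efficiency is $C_n^\lambda$. -/

import Mathlib

/-! Conventions.  All indices, entries, tableau values and latitudes lie in `Fin n = {0, …, n - 1}`
and stand for the elements `1, …, n` of `[n]`, that is, everything is shifted down by one.
Differences such as `β x - β y` or `λ j - j + i` and comparisons are not affected by the shift,
and `β` is upper iff `i ≤ β i`.  Elements `q` of a divider set `R ⊆ {1, …, n - 1}` are not shifted: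
the index `i : Fin n` lies to the left of the divider `q` iff `(i : ℕ) < q`. -/

namespace GVInput

open MvPolynomial

noncomputable section

variable {n : ℕ}

/-! ### Tuples with dividers -/

/-- An upper tuple: `β_i ≥ i` for all `i`. -/
def IsUpper (β : Fin n → Fin n) : Prop :=
  ∀ i, i ≤ β i

/-- Two indices lie in the same carrel if no divider separates them. -/
def SameCarrel (R : Set ℕ) (i k : Fin n) : Prop :=
  ∀ q ∈ R, ((i : ℕ) < q ↔ (k : ℕ) < q)

/-- `x` is the last index of its carrel. -/
def IsCarrelEnd (R : Set ℕ) (x : Fin n) : Prop :=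
  (x : ℕ) + 1 ∈ R ∨ (x : ℕ) + 1 = n

/-- The critical indices of `β`, found within each carrel from right to left: the last index of a
carrel is critical, and the next critical index to the left of a critical index `x` is the largest
`y < x` in the same carrel with `β x - β y > x - y`, if there is one. -/
inductive IsCritical (R : Set ℕ) (β : Fin n → Fin n) : Fin n → Prop
  | last (x : Fin n) : IsCarrelEnd R x → IsCritical R β x
  | next (x y : Fin n) : IsCritical R β x → SameCarrel R y x → y < x →
      ((β x : ℤ) - (β y : ℤ) > (x : ℤ) - (y : ℤ)) →
      (∀ z : Fin n, y < z → z < x → ¬ ((β x : ℤ) - (β z : ℤ) > (x : ℤ) - (z : ℤ))) →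
      IsCritical R β y

open Classical in
theorem critical_from_nonempty (R : Set ℕ) (β : Fin n → Fin n) (i : Fin n) :
    (Finset.univ.filter fun x => i ≤ x ∧ IsCritical R β x).Nonempty := by
  have hi := i.isLt
  refine ⟨⟨n - 1, by omega⟩, ?_⟩
  rw [Finset.mem_filter]
  refine ⟨Finset.mem_univ _, ?_, IsCritical.last _ (Or.inr ?_)⟩
  · rw [Fin.le_def]
    show (i : ℕ) ≤ n - 1
    omega
  · show n - 1 + 1 = n
    omega

open Classical in
/-- The leftmost critical index that is weakly to the right of `i`.  As the last index of the carrel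
of `i` is critical, it lies in the carrel of `i`. -/
def nextCritical (R : Set ℕ) (β : Fin n → Fin n) (i : Fin n) : Fin n :=
  (Finset.univ.filter fun x => i ≤ x ∧ IsCritical R β x).min' (critical_from_nonempty R β i)

/-- The platform `Ξ_R(β)`: its `i`-th entry is the critical entry at the leftmost critical index
weakly to the right of `i`. -/
def platform (R : Set ℕ) (β : Fin n → Fin n) : Fin n → Fin n :=
  fun i => β (nextCritical R β i)

/-- The critical list of `β` is a flag critical list: the entry at the last index `i` of a carrel
other than the last one is at most the leftmost critical entry of the following carrel (whose first
index is `j = i + 1`). -/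
def HasFlagCriticalList (R : Set ℕ) (β : Fin n → Fin n) : Prop :=
  ∀ i j : Fin n, (i : ℕ) + 1 ∈ R → (j : ℕ) = (i : ℕ) + 1 → β i ≤ β (nextCritical R β j)

/-- Gapless core tuples. -/
def IsGaplessCore (R : Set ℕ) (β : Fin n → Fin n) : Prop :=
  IsUpper β ∧ HasFlagCriticalList R β

/-- Upper tuples that are bounded by their platform. -/
def IsBoundedByPlatform (R : Set ℕ) (β : Fin n → Fin n) : Prop :=
  IsUpper β ∧ ∀ i, β i ≤ platform R β i

/-! ### Parabolic Catalan numbers -/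

/-- An `R`-permutation is a permutation, in one-line notation, that increases in each carrel. -/
def IsRPermutation (R : Set ℕ) (π : Equiv.Perm (Fin n)) : Prop :=
  ∀ i k : Fin n, i < k → SameCarrel R i k → π i < π k

/-- `π` contains the pattern 312 at indices `a`, `b`, `c`, with dividers between `a` and `b` and
between `b` and `c`. -/
def Contains312 (R : Set ℕ) (π : Equiv.Perm (Fin n)) : Prop :=
  ∃ q ∈ R, ∃ q' ∈ R, ∃ a b c : Fin n,
    (a : ℕ) < q ∧ q ≤ (b : ℕ) ∧ (b : ℕ) < q' ∧ q' ≤ (c : ℕ) ∧ π b < π c ∧ π c < π a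

/-- The number of `R`-312-avoiding permutations. -/
def parabolicCatalan (n : ℕ) (R : Set ℕ) : ℕ :=
  {π : Equiv.Perm (Fin n) | IsRPermutation R π ∧ ¬ Contains312 R π}.ncard

/-! ### Shapes, tableaux, polynomials -/

/-- The length of the `j`-th column (`j = 0, 1, …`) of the shape with row lengths `lam`. -/
def colLength (lam : Fin n → ℕ) (j : ℕ) : ℕ :=
  (Finset.univ.filter fun i => j < lam i).card

/-- `R_λ`: the set of the lengths of the (nonempty) columns of `λ` that are less than `n`. -/
def dividers (lam : Fin n → ℕ) : Set ℕ :=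
  {q | q < n ∧ ∃ j, (∃ i, j < lam i) ∧ q = colLength lam j}

/-- Fillings of the shape with row lengths `lam` with values from `[n]`; `T i j` is the value in
row `i` and column `j`. -/
abbrev Filling (lam : Fin n → ℕ) : Type :=
  (i : Fin n) → Fin (lam i) → Fin n

/-- Semistandard: weakly increasing along rows and strictly increasing down columns. -/
def IsSemistandard (lam : Fin n → ℕ) (T : Filling lam) : Prop :=
  (∀ i, Monotone (T i)) ∧
    ∀ (i i' : Fin n) (j : ℕ) (hj : j < lam i) (hj' : j < lam i'),
      i < i' → T i ⟨j, hj⟩ < T i' ⟨j, hj'⟩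

/-- The row bound set of tableaux `S_λ(β)`. -/
def rowBoundSet (lam : Fin n → ℕ) (β : Fin n → Fin n) : Set (Filling lam) :=
  {T | IsSemistandard lam T ∧ ∀ i j, T i j ≤ β i}

open Classical in
/-- The row bound sum `s_λ(β; x)`, which is the flagged Schur polynomial if `β` is a flag. -/
def rowBoundSum (lam : Fin n → ℕ) (β : Fin n → Fin n) : MvPolynomial (Fin n) ℤ :=
  ∑ T ∈ Finset.univ.filter (fun T : Filling lam => T ∈ rowBoundSet lam β),
    ∏ i, ∏ j, X (T i j)

/-- `h_u(i, k; x)`: the complete homogeneous symmetric polynomial of degree `u` in the variables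
`x_i, …, x_k`, which is `0` if `u < 0`. -/
def hPoly (u : ℤ) (i k : Fin n) : MvPolynomial (Fin n) ℤ :=
  if 0 ≤ u then
    rename Subtype.val (hsymm {t : Fin n // i ≤ t ∧ t ≤ k} ℤ u.toNat)
  else 0

/-- The matrix of the Gessel–Viennot determinant, with `(i, j)` entry
`h_{λ_j - j + i}(i, β_j; x)`. -/
def gvMatrix (lam : Fin n → ℕ) (β : Fin n → Fin n) :
    Matrix (Fin n) (Fin n) (MvPolynomial (Fin n) ℤ) :=
  Matrix.of fun i j => hPoly ((lam j : ℤ) - (j : ℤ) + (i : ℤ)) i (β j)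

/-- The total number of monomials among the entries of the Gessel–Viennot determinant. -/
def monomialCount (lam : Fin n → ℕ) (β : Fin n → Fin n) : ℕ :=
  ∑ i, ∑ j, (gvMatrix lam β i j).support.card

/-! ### Lattice paths -/

/-- A unit step: easterly (first coordinate) or southerly (second coordinate, the depth). -/
def Step (P Q : ℕ × ℕ) : Prop :=
  Q = (P.1 + 1, P.2) ∨ Q = (P.1, P.2 + 1)

/-- `p` lists the successive lattice points of a lattice path with source `A` and sink `B`. -/
def IsLatticePath (A B : ℕ × ℕ) (p : List (ℕ × ℕ)) : Prop :=
  p.head? = some A ∧ p.getLast? = some B ∧ p.IsChain Step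

/-- The source of the `m`-th component of an `n`-path. -/
def source (m : Fin n) : ℕ × ℕ :=
  (n - 1 - (m : ℕ), (m : ℕ))

/-- The `m`-th terminal of `(λ, β)`. -/
def terminal (lam : Fin n → ℕ) (β : Fin n → Fin n) (m : Fin n) : ℕ × ℕ :=
  (lam m + (n - 1 - (m : ℕ)), (β m : ℕ))

/-- The disjoint `n`-paths whose `m`-th component runs from the `m`-th source to the `π m`-th
terminal. -/
def disjointPaths (lam : Fin n → ℕ) (β : Fin n → Fin n) (π : Equiv.Perm (Fin n)) :
    Set (Fin n → List (ℕ × ℕ)) :=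
  {Λ | (∀ m, IsLatticePath (source m) (terminal lam β (π m)) (Λ m)) ∧
    ∀ m m', m ≠ m' → (Λ m).Disjoint (Λ m')}

/-- The terminal pair `(λ, β)` is nonpermutable. -/
def Nonpermutable (lam : Fin n → ℕ) (β : Fin n → Fin n) : Prop :=
  ∀ π : Equiv.Perm (Fin n), π ≠ 1 → disjointPaths lam β π = ∅

/-! ### Efficiency -/

/-- A valid upper input: an upper tuple to which the Gessel–Viennot method applies. -/
def IsValidInput (lam : Fin n → ℕ) (β : Fin n → Fin n) : Prop :=
  IsUpper β ∧ Nonpermutable lam β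

/-- `η` is a gapless core tuple bounded by its platform, and its Gessel–Viennot determinant has
fewer monomials among its entries than that of any other such tuple whose determinant produces the
polynomial `s_λ(η; x)`. -/
def AttainsMaxEfficiency (lam : Fin n → ℕ) (η : Fin n → Fin n) : Prop :=
  (IsGaplessCore (dividers lam) η ∧ IsBoundedByPlatform (dividers lam) η) ∧
    ∀ η' : Fin n → Fin n,
      IsGaplessCore (dividers lam) η' → IsBoundedByPlatform (dividers lam) η' → η' ≠ η →
      (gvMatrix lam η').det = rowBoundSum lam η →
      monomialCount lam η < monomialCount lam η'

end

end GVInput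

/-! The core of a tuple lowers its entries as far as possible without changing the critical entries.
Between a tuple's core and its platform, neither the row bound set nor the Gessel–Viennot
determinant changes, and on flags the determinant is the flagged Schur polynomial; so for a gapless
core tuple bounded by its platform it equals the row bound sum, and the core gives the fewest
monomials. The content of the largest tableau with row bounds `β` is determined by the row bound
sum, and it determines the key sets of `β` (the columns of that tableau), hence the core. Thus the
inputs of maximum efficiency are the gapless tuples, that is, the gapless core tuples equal to their
cores, and all of them are valid. Finally, the key sets of a gapless tuple are nested and are the
sets of initial entries of a unique `R`-permutation; the permutations that occur are exactly those
which avoid 312. -/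

namespace GVInput

open MvPolynomial

variable {n : ℕ}

section CompleteHomogeneous

theorem prod_map_X_eq_monomial {σ R : Type*} [DecidableEq σ] [CommSemiring R] (s : Multiset σ) :
    (s.map (X : σ → MvPolynomial σ R)).prod = monomial (Multiset.toFinsupp s) 1 := by
  induction s using Multiset.induction_on with
  | empty => simp
  | cons a s ih =>
    rw [Multiset.map_cons, Multiset.prod_cons, ih, ← Multiset.singleton_add, map_add,
      Multiset.toFinsupp_singleton, X, monomial_mul, one_mul]

theorem coeff_hsymm {σ R : Type*} [Fintype σ] [DecidableEq σ] [CommSemiring R] (m : ℕ)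
    (d : σ →₀ ℕ) : coeff d (hsymm σ R m) = if d.degree = m then 1 else 0 := by
  have hcard : d.toMultiset.card = d.degree := Finsupp.card_toMultiset d
  simp only [hsymm, prod_map_X_eq_monomial, coeff_sum, coeff_monomial, Multiset.toFinsupp_eq_iff]
  split_ifs with hd
  · exact (Fintype.sum_eq_single (α := Sym σ m) ⟨d.toMultiset, hcard.trans hd⟩
      fun s hs => if_neg fun h => hs (Subtype.ext h)).trans (if_pos rfl)
  · exact Finset.sum_eq_zero fun s _ => if_neg fun h => hd (by rw [← hcard, ← h, s.2])

variable {u : ℤ} {i k k' : Fin n}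

theorem coeff_hPoly (u : ℤ) (i k : Fin n) (d : Fin n →₀ ℕ) :
    coeff d (hPoly u i k) =
      if (d.degree : ℤ) = u ∧ d.support ⊆ Finset.Icc i k then 1 else 0 := by
  unfold hPoly
  split_ifs with hu hd hd
  · obtain ⟨e, rfl⟩ : ∃ e : {t : Fin n // i ≤ t ∧ t ≤ k} →₀ ℕ, e.mapDomain Subtype.val = d := by
      refine ⟨d.subtypeDomain _, ?_⟩
      rw [← Function.Embedding.coe_subtype, ← Finsupp.embDomain_eq_mapDomain,
        ← Finsupp.extendDomain_eq_embDomain_subtype, Finsupp.extendDomain_subtypeDomain]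
      exact fun t ht => Finset.mem_Icc.1 (hd.2 ht)
    rw [coeff_rename_mapDomain _ Subtype.val_injective, coeff_hsymm, if_pos]
    rw [← hd.1, Finsupp.degree_mapDomain, Int.toNat_natCast]
  · refine coeff_rename_eq_zero _ _ _ ?_
    rintro e rfl
    rw [coeff_hsymm, if_neg]
    rintro he
    refine hd ⟨by rw [Finsupp.degree_mapDomain, he, Int.toNat_of_nonneg hu], fun t ht => ?_⟩
    obtain ⟨s, -, rfl⟩ := Finset.mem_image.1 (Finsupp.mapDomain_support ht)
    exact Finset.mem_Icc.2 s.2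
  · omega
  · rfl

theorem mem_support_hPoly :
    d ∈ (hPoly u i k).support ↔ (d.degree : ℤ) = u ∧ d.support ⊆ Finset.Icc i k := by
  simp [mem_support_iff, coeff_hPoly]

theorem hPoly_eq_zero_of_lt (hu : u ≠ 0) (hk : k < i) : hPoly u i k = 0 := by
  refine support_eq_empty.1 (Finset.eq_empty_of_forall_notMem fun d hd => hu ?_)
  obtain ⟨hdeg, hsub⟩ := mem_support_hPoly.1 hd
  rw [Finset.Icc_eq_empty_of_lt hk, Finset.subset_empty, Finsupp.support_eq_empty] at hsub
  simpa [hsub] using hdeg.symm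

theorem hPoly_zero (i k : Fin n) : hPoly 0 i k = 1 := by
  simp [hPoly]

theorem hPoly_eq_add (hk : (k' : ℕ) + 1 = k) (h : i ≤ k ∨ u ≠ 1) :
    hPoly u i k = hPoly u i k' + X k * hPoly (u - 1) i k := by
  have hIcc : Finset.Icc i k' = (Finset.Icc i k).erase k := by
    ext t
    simp only [Finset.mem_erase, Finset.mem_Icc, Fin.le_def, ne_eq, Fin.ext_iff]
    omega
  rcases lt_or_ge k i with hki | hik
  · have hk'i : k' < i := lt_trans (Fin.lt_def.2 (by omega)) hki
    have hu : u - 1 ≠ 0 := sub_ne_zero.2 (h.resolve_left hki.not_ge)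
    rw [hPoly_eq_zero_of_lt hu hki, mul_zero, add_zero]
    rcases eq_or_ne u 0 with rfl | hu0
    · rw [hPoly_zero, hPoly_zero]
    · rw [hPoly_eq_zero_of_lt hu0 hki, hPoly_eq_zero_of_lt hu0 hk'i]
  ext d
  simp only [coeff_add, coeff_X_mul', coeff_hPoly, hIcc, Finset.subset_erase]
  by_cases hd : k ∈ d.support
  · obtain ⟨e, rfl⟩ := exists_add_of_le (Finsupp.single_le_iff.2
      (Nat.one_le_iff_ne_zero.2 (Finsupp.mem_support_iff.1 hd)))
    have hsupp : (Finsupp.single k 1 + e).support = insert k e.support := by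
      ext t
      by_cases htk : t = k <;> simp [htk]
    have hdeg : 1 + (e.degree : ℤ) = u ↔ (e.degree : ℤ) = u - 1 := by omega
    simp [hsupp, Finset.insert_subset_iff, hik, hdeg]
  · simp [hd]

theorem hPoly_self (m : ℕ) (i : Fin n) : hPoly (m : ℤ) i i = X i ^ m := by
  ext d
  simp only [coeff_hPoly, X_pow_eq_monomial, coeff_monomial, Finset.Icc_self, Nat.cast_inj]
  refine if_congr ⟨?_, ?_⟩ rfl rfl
  · rintro ⟨rfl, hsub⟩
    rw [Finsupp.support_subset_singleton.1 hsub, Finsupp.degree_single]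
  · rintro rfl
    exact ⟨Finsupp.degree_single _ _, Finsupp.support_single_subset⟩

theorem support_hPoly_subset (h : k ≤ k') : (hPoly u i k).support ⊆ (hPoly u i k').support := by
  intro d
  simp only [mem_support_hPoly]
  exact And.imp_right fun hsub => hsub.trans (Finset.Icc_subset_Icc_right h)

theorem card_support_hPoly_lt (h : k < k') (hi : i ≤ k') (hu : 0 < u) :
    (hPoly u i k).support.card < (hPoly u i k').support.card := by
  lift u to ℕ using hu.le
  have hsupp : (Finsupp.single k' u).support = {k'} := by
    simp [(Int.natCast_pos.1 hu).ne']
  refine Finset.card_lt_card ((Finset.ssubset_iff_of_subset (support_hPoly_subset h.le)).2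
    ⟨Finsupp.single k' u, ?_, ?_⟩)
  · simp only [mem_support_hPoly, hsupp, Finsupp.degree_single, Finset.singleton_subset_iff,
      Finset.mem_Icc, hi, le_rfl, and_self]
  · simp only [mem_support_hPoly, hsupp, Finset.singleton_subset_iff, Finset.mem_Icc, h.not_ge,
      and_false, not_false_eq_true]

end CompleteHomogeneous

section MonomialCount

variable {lam : Fin n → ℕ} {β β' : Fin n → Fin n}

theorem card_support_gvMatrix_le (h : β ≤ β') (i j : Fin n) :
    (gvMatrix lam β i j).support.card ≤ (gvMatrix lam β' i j).support.card :=
  Finset.card_le_card (support_hPoly_subset (h j))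

theorem monomialCount_mono : Monotone (monomialCount lam) := fun _ _ h =>
  Finset.sum_le_sum fun i _ => Finset.sum_le_sum fun j _ => card_support_gvMatrix_le h i j

/-- At a column `j` with `β j < β' j` the entry in row `β' j` has positive degree and gains the
monomials that involve the variable `β' j`. -/
theorem monomialCount_lt (hβ : IsUpper β) (h : β < β') :
    monomialCount lam β < monomialCount lam β' := by
  obtain ⟨hle, j, hj⟩ := Pi.lt_def.1 h
  have hdeg : 0 < (lam j : ℤ) - (j : ℤ) + (β' j : ℤ) := by
    have := Fin.le_def.1 (hβ j)
    have := Fin.lt_def.1 hj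
    omega
  exact Finset.sum_lt_sum
    (fun i _ => Finset.sum_le_sum fun j _ => card_support_gvMatrix_le hle i j)
    ⟨β' j, Finset.mem_univ _, Finset.sum_lt_sum (fun l _ => card_support_gvMatrix_le hle _ l)
      ⟨j, Finset.mem_univ _, card_support_hPoly_lt hj le_rfl hdeg⟩⟩

end MonomialCount

section Critical

variable {R : Set ℕ} {β : Fin n → Fin n} {i k x y z : Fin n}

theorem SameCarrel.refl (R : Set ℕ) (i : Fin n) : SameCarrel R i i := fun _ _ => Iff.rfl

theorem SameCarrel.symm (h : SameCarrel R i k) : SameCarrel R k i :=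
  fun q hq => (h q hq).symm

theorem SameCarrel.trans (h : SameCarrel R i k) (h' : SameCarrel R k x) : SameCarrel R i x :=
  fun q hq => (h q hq).trans (h' q hq)

theorem SameCarrel.of_subinterval (h : SameCarrel R i k) (hix : i ≤ x) (hxy : x ≤ y)
    (hyk : y ≤ k) : SameCarrel R x y := by
  intro q hq
  have := h q hq
  omega

theorem exists_isCarrelEnd (R : Set ℕ) (i : Fin n) :
    ∃ x, i ≤ x ∧ SameCarrel R i x ∧ IsCarrelEnd R x := by
  obtain ⟨x, hix, hx⟩ := (Set.toFinite {x | SameCarrel R i x}).exists_le_maximal (.refl R i)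
  refine ⟨x, hix, hx.prop, or_iff_not_imp_right.2 fun hxn => ?_⟩
  by_contra hxR
  have hsucc : SameCarrel R i ⟨x + 1, by omega⟩ := by
    intro q hq
    have := hx.prop q hq
    have : q ≠ x + 1 := fun h => hxR (h ▸ hq)
    dsimp only
    omega
  have : (⟨x + 1, by omega⟩ : Fin n) ≤ x := hx.le_of_ge hsucc (Fin.le_def.2 (Nat.le_succ _))
  exact Nat.not_succ_le_self _ (Fin.le_def.1 this)

theorem IsCarrelEnd.le_iff (hx : IsCarrelEnd R x) (h : SameCarrel R i k) : i ≤ x ↔ k ≤ x := by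
  rcases hx with hx | hx
  · have := h _ hx
    omega
  · omega

theorem IsCarrelEnd.le_of_sameCarrel (hx : IsCarrelEnd R x) (h : SameCarrel R x z) : z ≤ x :=
  (hx.le_iff h).1 le_rfl

/-- The excess `β i - i`, in terms of which criticality is a condition on right-to-left minima. -/
def excess (β : Fin n → Fin n) (i : Fin n) : ℤ := (β i : ℤ) - (i : ℤ)

theorem excess_le_excess_of_strictMonoOn (h : StrictMonoOn β (Set.Icc i k)) (hik : i ≤ k) :
    excess β i ≤ excess β k := by
  have hmaps : Set.MapsTo β (Finset.Icc i k) (Finset.Icc (β i) (β k)) := fun a ha => by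
    rw [Finset.coe_Icc] at ha ⊢
    exact ⟨h.monotoneOn (Set.left_mem_Icc.2 hik) ha ha.1,
      h.monotoneOn ha (Set.right_mem_Icc.2 hik) ha.2⟩
  have hcard := Finset.card_le_card_of_injOn β hmaps (by simpa using h.injOn)
  rw [Fin.card_Icc, Fin.card_Icc] at hcard
  unfold excess
  omega

theorem IsCritical.exists_isCritical_lt (hx : IsCritical R β x) (hyx : SameCarrel R y x)
    (hlt : y < x) (he : excess β y < excess β x) : ∃ z, y ≤ z ∧ z < x ∧ IsCritical R β z := by
  obtain ⟨z, hyz, hz⟩ :=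
    (Set.toFinite {z | z < x ∧ excess β z < excess β x}).exists_le_maximal ⟨hlt, he⟩
  refine ⟨z, hyz, hz.prop.1, .next x z hx (hyx.of_subinterval hyz hz.prop.1.le le_rfl) hz.prop.1
    ?_ fun w hzw hwx hw => hzw.not_ge (hz.le_of_ge ⟨hwx, ?_⟩ hzw.le)⟩
  · have := hz.prop.2
    unfold excess at this
    omega
  · unfold excess
    omega

theorem IsCritical.excess_lt (hx : IsCritical R β x) :
    ∀ z, x < z → SameCarrel R x z → excess β x < excess β z := by
  induction hx with
  | last x h => exact fun z hz hs => absurd (h.le_of_sameCarrel hs) hz.not_ge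
  | next x y hx hs hlt he hskip ih =>
    intro z hyz hsz
    have hxy : excess β y < excess β x := by unfold excess; omega
    rcases lt_trichotomy z x with h | rfl | h
    · have := hskip z hyz h
      unfold excess at *
      omega
    · exact hxy
    · exact hxy.trans (ih z h (hs.symm.trans hsz))

theorem le_nextCritical (R : Set ℕ) (β : Fin n → Fin n) (i : Fin n) : i ≤ nextCritical R β i := by
  classical
  exact (Finset.mem_filter.1 (Finset.min'_mem _ (critical_from_nonempty R β i))).2.1

theorem isCritical_nextCritical (R : Set ℕ) (β : Fin n → Fin n) (i : Fin n) :
    IsCritical R β (nextCritical R β i) := by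
  classical
  exact (Finset.mem_filter.1 (Finset.min'_mem _ (critical_from_nonempty R β i))).2.2

theorem nextCritical_le (h : i ≤ x) (hx : IsCritical R β x) : nextCritical R β i ≤ x := by
  classical
  exact Finset.min'_le _ _ (Finset.mem_filter.2 ⟨Finset.mem_univ _, h, hx⟩)

theorem IsCritical.nextCritical_eq (hx : IsCritical R β x) : nextCritical R β x = x :=
  (nextCritical_le le_rfl hx).antisymm (le_nextCritical R β x)

theorem nextCritical_mono (R : Set ℕ) (β : Fin n → Fin n) : Monotone (nextCritical R β) :=
  fun _ k h => nextCritical_le (h.trans (le_nextCritical R β k)) (isCritical_nextCritical R β k)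

theorem nextCritical_eq_of_le_nextCritical (hik : i ≤ k) (hk : k ≤ nextCritical R β i) :
    nextCritical R β k = nextCritical R β i :=
  (nextCritical_le hk (isCritical_nextCritical R β i)).antisymm (nextCritical_mono R β hik)

theorem sameCarrel_nextCritical (R : Set ℕ) (β : Fin n → Fin n) (i : Fin n) :
    SameCarrel R i (nextCritical R β i) := by
  obtain ⟨x, hix, hs, hx⟩ := exists_isCarrelEnd R i
  exact hs.of_subinterval le_rfl (le_nextCritical R β i) (nextCritical_le hix (.last x hx))

theorem excess_nextCritical_le (hiz : i ≤ z) (hs : SameCarrel R i z) :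
    excess β (nextCritical R β i) ≤ excess β z := by
  have hcrit := isCritical_nextCritical R β i
  have hcar := sameCarrel_nextCritical R β i
  rcases lt_trichotomy (nextCritical R β i) z with h | h | h
  · exact (hcrit.excess_lt z h (hcar.symm.trans hs)).le
  · rw [h]
  · by_contra! he
    obtain ⟨y, hzy, hlt, hy⟩ := hcrit.exists_isCritical_lt (hs.symm.trans hcar) h he
    exact hlt.not_ge (nextCritical_le (hiz.trans hzy) hy)

theorem isCritical_iff :
    IsCritical R β x ↔ ∀ z, x < z → SameCarrel R x z → excess β x < excess β z := by
  refine ⟨IsCritical.excess_lt, fun h => ?_⟩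
  rcases (le_nextCritical R β x).eq_or_lt with hx | hx
  · exact hx ▸ isCritical_nextCritical R β x
  · exact absurd (h _ hx (sameCarrel_nextCritical R β x))
      (excess_nextCritical_le le_rfl (.refl R x)).not_gt

theorem SameCarrel.platform_le (hs : SameCarrel R i k) (hik : i ≤ k) :
    platform R β i ≤ platform R β k := by
  have hle := nextCritical_mono R β hik
  have he := excess_nextCritical_le (β := β) (hik.trans (le_nextCritical R β k))
    (hs.trans (sameCarrel_nextCritical R β k))
  unfold excess at he
  unfold platform
  omega

theorem IsGaplessCore.monotone_platform (h : IsGaplessCore R β) : Monotone (platform R β) := by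
  cases n with
  | zero => exact fun i => i.elim0
  | succ n =>
  refine Fin.monotone_iff_le_succ.2 fun i => ?_
  by_cases hi : (i : ℕ) + 1 ∈ R
  · have hcrit : IsCritical R β i.castSucc := .last _ (.inl hi)
    unfold platform
    rw [hcrit.nextCritical_eq]
    exact h.2 i.castSucc i.succ hi rfl
  · refine SameCarrel.platform_le (fun q hq => ?_) i.castSucc_lt_succ.le
    have : q ≠ i + 1 := fun h => hi (h ▸ hq)
    simp only [Fin.val_castSucc, Fin.val_succ]
    omega

end Critical

section Core

variable {R : Set ℕ} {β : Fin n → Fin n} {i x : Fin n}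

/-- The smallest upper tuple with the same critical entries as `β`: to the left of a critical index
its entries decrease by one until the previous critical index.  The subtraction does not truncate
when `β` is upper. -/
noncomputable def core (R : Set ℕ) (β : Fin n → Fin n) (i : Fin n) : Fin n :=
  ⟨(platform R β i : ℕ) - ((nextCritical R β i : ℕ) - (i : ℕ)),
    (Nat.sub_le _ _).trans_lt (platform R β i).isLt⟩

theorem excess_core (hβ : IsUpper β) (i : Fin n) :
    excess (core R β) i = excess β (nextCritical R β i) := by
  have := le_nextCritical R β i
  have := hβ (nextCritical R β i)
  simp only [excess, core, platform]
  omega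

theorem IsCritical.core_eq (hi : IsCritical R β i) : core R β i = β i := by
  simp [core, platform, hi.nextCritical_eq]

theorem IsUpper.core (hβ : IsUpper β) : IsUpper (core R β) := by
  intro i
  have he := excess_core (R := R) hβ i
  have := hβ (nextCritical R β i)
  unfold excess at he
  omega

theorem core_le (hβ : IsUpper β) : core R β ≤ β := by
  refine fun i => Fin.le_def.2 ?_
  have he := excess_core (R := R) hβ i
  have hle := excess_nextCritical_le (β := β) le_rfl (.refl R i)
  unfold excess at he hle
  omega

theorem core_le_platform (R : Set ℕ) (β : Fin n → Fin n) : core R β ≤ platform R β :=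
  fun _ => Fin.le_def.2 (Nat.sub_le _ _)

theorem isCritical_core_iff (hβ : IsUpper β) : IsCritical R (core R β) x ↔ IsCritical R β x := by
  refine ⟨fun h => ?_, fun h => isCritical_iff.2 fun z hxz hs => ?_⟩
  · rcases (le_nextCritical R β x).eq_or_lt with hx | hx
    · exact hx ▸ isCritical_nextCritical R β x
    · have := h.excess_lt _ hx (sameCarrel_nextCritical R β x)
      rw [excess_core hβ, excess_core hβ, (isCritical_nextCritical R β x).nextCritical_eq] at this
      exact absurd this (lt_irrefl _)
  · rw [excess_core hβ, excess_core hβ, h.nextCritical_eq]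
    exact h.excess_lt _ (hxz.trans_le (le_nextCritical R β z))
      (hs.trans (sameCarrel_nextCritical R β z))

theorem nextCritical_core (hβ : IsUpper β) : nextCritical R (core R β) = nextCritical R β := by
  funext i
  exact le_antisymm
    (nextCritical_le (le_nextCritical R β i)
      ((isCritical_core_iff hβ).2 (isCritical_nextCritical R β i)))
    (nextCritical_le (le_nextCritical R _ i)
      ((isCritical_core_iff hβ).1 (isCritical_nextCritical R _ i)))

theorem platform_core (hβ : IsUpper β) : platform R (core R β) = platform R β := by
  funext i
  unfold platform
  rw [nextCritical_core hβ, (isCritical_nextCritical R β i).core_eq]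

theorem IsUpper.isBoundedByPlatform_core (h : IsUpper β) :
    IsBoundedByPlatform R (GVInput.core R β) :=
  ⟨h.core, fun i => platform_core h ▸ core_le_platform R β i⟩

end Core

section Gapless

variable {R : Set ℕ} {β : Fin n → Fin n} {i k : Fin n}

/-- The entries increase strictly within each carrel. -/
def IsCarrelIncreasing (R : Set ℕ) (β : Fin n → Fin n) : Prop :=
  ∀ ⦃i k : Fin n⦄, i < k → SameCarrel R i k → β i < β k

/-- Gapless tuples: the gapless core tuples whose entries increase strictly within each carrel.
They turn out to be the cores of the gapless core tuples. -/
def IsGapless (R : Set ℕ) (β : Fin n → Fin n) : Prop :=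
  IsGaplessCore R β ∧ IsCarrelIncreasing R β

theorem IsUpper.isCarrelIncreasing_core (h : IsUpper β) :
    IsCarrelIncreasing R (GVInput.core R β) := by
  intro i k hik hs
  have hi := excess_core (R := R) h i
  have hk := excess_core (R := R) h k
  have hle := excess_nextCritical_le (β := β) (hik.le.trans (le_nextCritical R β k))
    (hs.trans (sameCarrel_nextCritical R β k))
  unfold excess at hi hk hle
  omega

theorem IsCarrelIncreasing.excess_le (h : IsCarrelIncreasing R β) (hik : i ≤ k)
    (hs : SameCarrel R i k) : excess β i ≤ excess β k :=
  excess_le_excess_of_strictMonoOn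
    (fun _ ha _ hb hab => h hab (hs.of_subinterval ha.1 hab.le hb.2)) hik

theorem IsCarrelIncreasing.core_eq (h : IsCarrelIncreasing R β) (hβ : IsUpper β) :
    core R β = β := by
  refine (core_le hβ).antisymm fun i => Fin.le_def.2 ?_
  have he := excess_core (R := R) hβ i
  have hle := h.excess_le (le_nextCritical R β i) (sameCarrel_nextCritical R β i)
  unfold excess at he hle
  omega

theorem IsGaplessCore.isGapless_core (h : IsGaplessCore R β) : IsGapless R (core R β) := by
  refine ⟨⟨h.1.core, fun i j hi hj => ?_⟩, h.1.isCarrelIncreasing_core⟩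
  rw [(IsCritical.last i (.inl hi)).core_eq, nextCritical_core h.1,
    (isCritical_nextCritical R β j).core_eq]
  exact h.2 i j hi hj

theorem IsGapless.core_eq (h : IsGapless R β) : core R β = β := h.2.core_eq h.1.1

theorem IsGapless.isBoundedByPlatform (h : IsGapless R β) : IsBoundedByPlatform R β :=
  h.core_eq ▸ h.1.1.isBoundedByPlatform_core

end Gapless

section Shape
variable {lam : Fin n → ℕ}

theorem lt_colLength_iff (hlam : Antitone lam) (i : Fin n) (j : ℕ) :
    (i : ℕ) < colLength lam j ↔ j < lam i := by
  constructor
  · refine fun h => by_contra fun hij => ?_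
    have hsub : (Finset.univ.filter fun k => j < lam k) ⊆ Finset.Iio i := fun k hk => by
      rw [Finset.mem_filter] at hk
      exact Finset.mem_Iio.2 (not_le.1 fun hik => hij (hk.2.trans_le (hlam hik)))
    exact h.not_ge ((Finset.card_le_card hsub).trans_eq (Fin.card_Iio i))
  · intro h
    have hsub : Finset.Iic i ⊆ Finset.univ.filter fun k => j < lam k := fun k hk =>
      Finset.mem_filter.2 ⟨Finset.mem_univ k, h.trans_le (hlam (Finset.mem_Iic.1 hk))⟩
    exact (Fin.card_Iic i).symm.trans_le (Finset.card_le_card hsub)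

theorem SameCarrel.lam_eq (hlam : Antitone lam) {i k : Fin n}
    (h : SameCarrel (dividers lam) i k) : lam i = lam k := by
  wlog hik : i ≤ k generalizing i k
  · exact (this h.symm (not_le.1 hik).le).symm
  by_contra hne
  have hlt : lam k < lam i := lt_of_le_of_ne (hlam hik) (Ne.symm hne)
  have hi := (lt_colLength_iff hlam i (lam k)).2 hlt
  have hk := (lt_colLength_iff hlam k (lam k)).not.2 (lt_irrefl _)
  have := h (colLength lam (lam k)) ⟨by omega, lam k, ⟨i, hlt⟩, rfl⟩
  omega

end Shape

section Column

/-- The column of the Gessel–Viennot matrix that belongs to a terminal at depth `k` whose row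
length, diminished by the row index, is `a`. -/
noncomputable def gvCol (a : ℤ) (k : Fin n) : Fin n → MvPolynomial (Fin n) ℤ :=
  fun i => hPoly (a + (i : ℤ)) i k

theorem gvCol_eq_add {a : ℤ} {k k' : Fin n} (hk : (k' : ℕ) + 1 = k) (h : 0 < a + (k : ℤ)) :
    gvCol a k = gvCol a k' + (X k : MvPolynomial (Fin n) ℤ) • gvCol (a - 1) k := by
  funext i
  rw [Pi.add_apply, Pi.smul_apply, smul_eq_mul]
  unfold gvCol
  rw [show a - 1 + (i : ℤ) = a + i - 1 by ring]
  exact hPoly_eq_add hk (by omega)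

theorem gvMatrix_apply (lam : Fin n → ℕ) (β : Fin n → Fin n) (i j : Fin n) :
    gvMatrix lam β i j = gvCol ((lam j : ℤ) - (j : ℤ)) (β j) i := rfl

theorem gvMatrix_update (lam : Fin n → ℕ) (β : Fin n → Fin n) (j : Fin n) (m : ℕ) (k : Fin n) :
    gvMatrix (Function.update lam j m) (Function.update β j k) =
      (gvMatrix lam β).updateCol j (gvCol ((m : ℤ) - (j : ℤ)) k) := by
  ext1 i l
  rw [gvMatrix_apply, Matrix.updateCol_apply]
  split_ifs with h
  · rw [h, Function.update_self, Function.update_self]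
  · rw [Function.update_of_ne h, Function.update_of_ne h, gvMatrix_apply]

theorem gvMatrix_update_right (lam : Fin n → ℕ) (β : Fin n → Fin n) (j k : Fin n) :
    gvMatrix lam (Function.update β j k) =
      (gvMatrix lam β).updateCol j (gvCol ((lam j : ℤ) - (j : ℤ)) k) := by
  rw [← gvMatrix_update, Function.update_eq_self]

theorem gvMatrix_update_left (lam : Fin n → ℕ) (β : Fin n → Fin n) (j : Fin n) (m : ℕ) :
    gvMatrix (Function.update lam j m) β =
      (gvMatrix lam β).updateCol j (gvCol ((m : ℤ) - (j : ℤ)) (β j)) := by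
  rw [← gvMatrix_update, Function.update_eq_self]

theorem det_gvMatrix_eq_add (lam : Fin n → ℕ) (β : Fin n → Fin n) {j k' : Fin n}
    (hk : (k' : ℕ) + 1 = β j) (hj : j < β j) :
    (gvMatrix lam β).det = (gvMatrix lam (Function.update β j k')).det +
      X (β j) * ((gvMatrix lam β).updateCol j (gvCol ((lam j : ℤ) - (j : ℤ) - 1) (β j))).det := by
  conv_lhs => rw [← Function.update_eq_self j β]
  rw [gvMatrix_update_right, gvMatrix_update_right, ← Matrix.det_updateCol_smul,
    ← Matrix.det_updateCol_add, ← gvCol_eq_add hk (by omega)]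

theorem det_gvMatrix_id (lam : Fin n → ℕ) : (gvMatrix lam id).det = ∏ i, X i ^ lam i := by
  rw [Matrix.det_of_isUpperTriangular]
  · refine Finset.prod_congr rfl fun i _ => ?_
    rw [gvMatrix_apply, gvCol, sub_add_cancel, id, hPoly_self]
  · intro i j hij
    have hji : j < i := hij
    exact hPoly_eq_zero_of_lt (by omega) hji

/-- Applies the recursion of `gvCol_eq_add` repeatedly: the antidiagonal `k + d' = b`, occupied by
other columns of `M`, kills every correction term. -/
theorem det_updateCol_gvCol_eq {M : Matrix (Fin n) (Fin n) (MvPolynomial (Fin n) ℤ)}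
    {y b : Fin n} {a : ℤ} (hab : 0 ≤ a + (b : ℤ)) {d : ℕ} {k k₀ : Fin n}
    (hM : ∀ d' < d, ∃ l ≠ y, ∃ k : Fin n, (k : ℕ) + d' = b ∧
      ∀ i, M i l = gvCol (a + (d' : ℤ)) k i)
    (hk₀ : (k₀ : ℕ) + d = b) (hk : k₀ ≤ k) (hkb : k ≤ b) :
    (M.updateCol y (gvCol (a + (d : ℤ)) k)).det =
      (M.updateCol y (gvCol (a + (d : ℤ)) k₀)).det := by
  induction d generalizing k k₀ with
  | zero => rw [show k = k₀ by omega]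
  | succ d ihd =>
    have hzero {k : Fin n} (hbk : (b : ℕ) ≤ k + d) (hkb : k ≤ b) :
        (M.updateCol y (gvCol (a + (d : ℤ)) k)).det = 0 := by
      obtain ⟨l, hly, k₁, hk₁, hl⟩ := hM d d.lt_succ_self
      rw [ihd (fun d' hd' => hM d' (hd'.trans d.lt_succ_self)) hk₁ (by omega) hkb]
      refine Matrix.det_zero_of_column_eq hly.symm fun i => ?_
      rw [Matrix.updateCol_self, Matrix.updateCol_ne hly, hl]
    obtain ⟨e, he⟩ : ∃ e, (k : ℕ) = k₀ + e := Nat.exists_eq_add_of_le hk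
    induction e generalizing k with
    | zero => rw [show k = k₀ by omega]
    | succ e ihe =>
      obtain ⟨k', hk'⟩ : ∃ k' : Fin n, (k' : ℕ) + 1 = k := ⟨⟨k₀ + e, by omega⟩, by simp; omega⟩
      rw [gvCol_eq_add hk' (by push_cast; omega), Matrix.det_updateCol_add,
        Matrix.det_updateCol_smul, ihe (k := k') (by omega) (by omega) (by omega),
        show a + ((d + 1 : ℕ) : ℤ) - 1 = a + (d : ℤ) by push_cast; ring,
        hzero (by omega) hkb, mul_zero, add_zero]

end Column

section Filling
variable {lam lam' : Fin n → ℕ} {β : Fin n → Fin n}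

theorem IsSemistandard.add_le_add (hlam : Antitone lam) {T : Filling lam}
    (hT : IsSemistandard lam T) {i k : Fin n} (hik : i ≤ k) {c : ℕ} (hi : c < lam i)
    (hk : c < lam k) : (T i ⟨c, hi⟩ : ℕ) + k ≤ T k ⟨c, hk⟩ + i := by
  obtain ⟨m, hm⟩ : ∃ m, (k : ℕ) = i + m := Nat.exists_eq_add_of_le hik
  induction m generalizing k with
  | zero =>
    obtain rfl : i = k := by omega
    rfl
  | succ m ih =>
    obtain ⟨l, hl⟩ : ∃ l : Fin n, (l : ℕ) = i + m := ⟨⟨i + m, by omega⟩, rfl⟩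
    have hlk : l < k := by omega
    have hcl : c < lam l := hk.trans_le (hlam hlk.le)
    have h1 := ih (by omega) hcl hl
    have h2 := hT.2 l k c hcl hk hlk
    omega

theorem IsSemistandard.le_apply (hlam : Antitone lam) {T : Filling lam}
    (hT : IsSemistandard lam T) (i : Fin n) (c : Fin (lam i)) : i ≤ T i c := by
  have h0 : (⟨0, i.pos⟩ : Fin n) ≤ i := Nat.zero_le _
  have := hT.add_le_add hlam h0 (c.isLt.trans_le (hlam h0)) c.isLt
  exact Fin.le_def.2 (by simpa using (Nat.le_add_left _ _).trans this)

theorem mem_rowBoundSet_update {T : Filling lam} {j k : Fin n} (hk : k ≤ β j) :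
    T ∈ rowBoundSet lam (Function.update β j k) ↔ T ∈ rowBoundSet lam β ∧ ∀ c, T j c ≤ k := by
  refine ⟨fun ⟨hT, h⟩ => ?_, fun ⟨⟨hT, h⟩, hj⟩ => ⟨hT, ?_⟩⟩
  · rw [Function.forall_update_iff β fun i b => ∀ c, T i c ≤ b] at h
    refine ⟨⟨hT, fun i c => ?_⟩, h.1⟩
    rcases eq_or_ne i j with rfl | hij
    exacts [(h.1 c).trans hk, h.2 i hij c]
  · rw [Function.forall_update_iff β fun i b => ∀ c, T i c ≤ b]
    exact ⟨hj, fun i _ => h i⟩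

theorem rowBoundSum_congr {β' : Fin n → Fin n}
    (h : rowBoundSet lam β = rowBoundSet lam β') : rowBoundSum lam β = rowBoundSum lam β' := by
  unfold rowBoundSum
  rw [h]

theorem rowBoundSum_id (hlam : Antitone lam) : rowBoundSum lam id = ∏ i, X i ^ lam i := by
  classical
  have h : (Finset.univ.filter fun T : Filling lam => T ∈ rowBoundSet lam id) =
      {fun i _ => i} := by
    ext T
    rw [Finset.mem_filter_univ, Finset.mem_singleton]
    constructor
    · exact fun hT => funext fun i => funext fun c =>
        le_antisymm (hT.2 i c) (hT.1.le_apply hlam i c)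
    · rintro rfl
      exact ⟨⟨fun i => monotone_const, fun i i' _ _ _ h => h⟩, fun i _ => le_rfl⟩
  unfold rowBoundSum
  rw [h, Finset.sum_singleton]
  simp only [Finset.prod_const, Finset.card_univ, Fintype.card_fin]

/-- The restriction of a filling to a smaller shape. -/
def restrict (h : lam' ≤ lam) (T : Filling lam) : Filling lam' :=
  fun i c => T i (Fin.castLE (h i) c)

/-- The extension of a filling to a larger shape by a constant value `v`. -/
def extend (lam : Fin n → ℕ) (v : Fin n) (T : Filling lam') : Filling lam :=
  fun i c => if h : (c : ℕ) < lam' i then T i ⟨c, h⟩ else v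

theorem restrict_extend (h : lam' ≤ lam) (v : Fin n) (T : Filling lam') :
    restrict h (extend lam v T) = T :=
  funext fun _ => funext fun c => dif_pos c.isLt

theorem extend_restrict (h : lam' ≤ lam) {v : Fin n} {T : Filling lam}
    (hv : ∀ i (c : Fin (lam i)), lam' i ≤ (c : ℕ) → T i c = v) :
    extend lam v (restrict h T) = T := by
  funext i c
  unfold extend
  split_ifs with hc
  exacts [rfl, (hv i c (not_lt.1 hc)).symm]

theorem restrict_mem_rowBoundSet (h : lam' ≤ lam) {T : Filling lam}
    (hT : T ∈ rowBoundSet lam β) : restrict h T ∈ rowBoundSet lam' β :=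
  ⟨⟨fun i _ _ hc => hT.1.1 i ((Fin.castLE_le_castLE_iff _).2 hc),
    fun i i' c _ _ hii => hT.1.2 i i' c _ _ hii⟩, fun i _ => hT.2 i _⟩

theorem prod_dite_lt {M : Type*} [CommMonoid M] {a b : ℕ} (h : a ≤ b) (f : Fin a → M) (x : M) :
    (∏ c : Fin b, if hc : (c : ℕ) < a then f ⟨c, hc⟩ else x) = x ^ (b - a) * ∏ c, f c := by
  obtain ⟨e, rfl⟩ := Nat.exists_eq_add_of_le h
  simp [Fin.prod_univ_add, mul_comm]

theorem prod_extend {M : Type*} [CommMonoid M] (h : lam' ≤ lam) (v : Fin n) (T : Filling lam')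
    (f : Fin n → M) : ∏ i, ∏ c, f (extend lam v T i c) =
      (∏ i, f v ^ (lam i - lam' i)) * ∏ i, ∏ c, f (T i c) := by
  rw [← Finset.prod_mul_distrib]
  refine Finset.prod_congr rfl fun i _ => ?_
  rw [← prod_dite_lt (h i)]
  refine Finset.prod_congr rfl fun c _ => ?_
  unfold extend
  split_ifs <;> rfl

end Filling

section RemoveBox
variable {lam : Fin n → ℕ} {β : Fin n → Fin n} {j : Fin n} {m : ℕ}

theorem update_le_iff_of_add_one_eq (hm : m + 1 = lam j) {i : Fin n} {c : ℕ} (hc : c < lam i) :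
    Function.update lam j m i ≤ c ↔ i = j ∧ c = m := by
  rcases eq_or_ne i j with rfl | hij
  · rw [Function.update_self]
    omega
  · rw [Function.update_of_ne hij]
    exact iff_of_false hc.not_ge fun h => hij h.1

theorem prod_pow_sub_update {M : Type*} [CommMonoid M] (hm : m + 1 = lam j) (x : M) :
    ∏ i, x ^ (lam i - Function.update lam j m i) = x := by
  rw [Finset.prod_eq_single j]
  · rw [Function.update_self, ← hm, Nat.add_sub_cancel_left, pow_one]
  · intro i _ hij
    rw [Function.update_of_ne hij, Nat.sub_self, pow_zero]
  · exact fun h => absurd (Finset.mem_univ j) h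

theorem extend_mem_rowBoundSet (hm : m + 1 = lam j) (hlam : ∀ l, j < l → lam l ≤ m)
    (hβ : ∀ l < j, β l < β j) {T : Filling (Function.update lam j m)}
    (hT : T ∈ rowBoundSet (Function.update lam j m) β) :
    extend lam (β j) T ∈ rowBoundSet lam β := by
  have hout {i : Fin n} {c : ℕ} (hc : c < lam i) (h : ¬ c < Function.update lam j m i) :
      i = j ∧ c = m := (update_le_iff_of_add_one_eq hm hc).1 (not_lt.1 h)
  refine ⟨⟨fun i c c' hcc => ?_, fun i i' c hc hc' hii => ?_⟩, fun i c => ?_⟩ <;>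
    dsimp only [extend]
  · split_ifs with h h' h'
    · exact hT.1.1 i hcc
    · obtain ⟨rfl, -⟩ := hout c'.isLt h'
      exact hT.2 _ _
    · omega
    · exact le_rfl
  · split_ifs with h h' h'
    · exact hT.1.2 i i' c h h' hii
    · obtain ⟨rfl, -⟩ := hout hc' h'
      exact (hT.2 _ _).trans_lt (hβ i hii)
    · obtain ⟨rfl, rfl⟩ := hout hc h
      exact absurd hc' (hlam i' hii).not_gt
    · obtain ⟨rfl, -⟩ := hout hc h
      exact absurd (hout hc' h').1 hii.ne'
  · split_ifs with h
    · exact hT.2 _ _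
    · obtain ⟨rfl, -⟩ := hout c.isLt h
      exact le_rfl

theorem rowBoundSum_eq_add {k' : Fin n} (hk : (k' : ℕ) + 1 = β j) (hm : m + 1 = lam j)
    (hlam : ∀ l, j < l → lam l ≤ m) (hβ : ∀ l < j, β l < β j) :
    rowBoundSum lam β = rowBoundSum lam (Function.update β j k') +
      X (β j) * rowBoundSum (Function.update lam j m) β := by
  classical
  have hle : Function.update lam j m ≤ lam := update_le_self_iff.2 (hm ▸ m.le_succ)
  have hmj : m < lam j := by omega
  have hsmall (T : Filling lam) (hT : T ∈ rowBoundSet lam β) :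
      (∀ c, T j c ≤ k') ↔ T j ⟨m, hmj⟩ ≠ β j :=
    ⟨fun h => (lt_of_le_of_lt (h _) (by omega)).ne, fun h c =>
      (hT.1.1 j (Fin.le_def.2 (by dsimp only; omega) : c ≤ ⟨m, hmj⟩)).trans
        (by have := lt_of_le_of_ne (hT.2 j ⟨m, hmj⟩) h; omega)⟩
  unfold rowBoundSum
  rw [← Finset.sum_filter_not_add_sum_filter _ fun T : Filling lam => T j ⟨m, hmj⟩ = β j,
    Finset.mul_sum]
  congr 1
  · refine Finset.sum_congr (Finset.ext fun T => ?_) fun _ _ => rfl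
    simp only [Finset.mem_filter, Finset.mem_univ, true_and,
      mem_rowBoundSet_update (show k' ≤ β j by omega)]
    exact and_congr_right fun hT => (hsmall T hT).symm
  · symm
    refine Finset.sum_bij' (fun T _ => extend lam (β j) T) (fun T _ => restrict hle T)
      (fun T hT => ?_) (fun T hT => ?_) (fun T _ => restrict_extend hle _ T) (fun T hT => ?_)
      (fun T _ => ?_)
    · rw [Finset.mem_filter_univ] at hT
      simp only [Finset.mem_filter, Finset.mem_univ, true_and]
      exact ⟨extend_mem_rowBoundSet hm hlam hβ hT, dif_neg (by simp)⟩
    · simp only [Finset.mem_filter, Finset.mem_univ, true_and] at hT ⊢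
      exact restrict_mem_rowBoundSet hle hT.1
    · simp only [Finset.mem_filter, Finset.mem_univ, true_and] at hT
      refine extend_restrict hle fun i c hc => ?_
      obtain ⟨rfl, hcm⟩ := (update_le_iff_of_add_one_eq hm c.isLt).1 hc
      exact (congrArg (T i) (Fin.ext hcm)).trans hT.2
    · rw [prod_extend hle, prod_pow_sub_update hm]

end RemoveBox

section FlaggedJacobiTrudi
variable {lam : Fin n → ℕ} {β : Fin n → Fin n}

theorem monotone_update {α γ : Type*} [PartialOrder α] [DecidableEq α] [Preorder γ] {f : α → γ}
    (hf : Monotone f) {j : α} {c : γ} (hlt : ∀ i < j, f i ≤ c) (hgt : ∀ i, j < i → c ≤ f i) :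
    Monotone (Function.update f j c) := by
  intro a b hab
  rcases hab.eq_or_lt with rfl | hlt_ab
  · exact le_rfl
  rcases eq_or_ne b j with rfl | hb
  · simpa only [Function.update_self, Function.update_of_ne hlt_ab.ne] using hlt a hlt_ab
  rw [Function.update_of_ne hb]
  rcases eq_or_ne a j with rfl | ha
  · simpa only [Function.update_self] using hgt b hlt_ab
  · simpa only [Function.update_of_ne ha] using hf hab

theorem exists_first_repetition (hβ : Monotone β) (hup : IsUpper β) (hid : β ≠ id) :
    ∃ j l : Fin n, (j : ℕ) + 1 = l ∧ j < β j ∧ β j = β l ∧ ∀ i < j, β i < β j := by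
  have hrep : ∃ j k, j < k ∧ β k = β j := by
    by_contra! h
    have hmono : StrictMono β := fun a b hab => (hβ hab.le).lt_of_ne (h a b hab).symm
    exact hid (funext fun i => le_antisymm hmono.apply_le (hup i))
  obtain ⟨j, ⟨k, hjk, hk⟩, hmin⟩ := wellFounded_lt.has_min {j | ∃ k, j < k ∧ β k = β j} hrep
  obtain ⟨l, hl⟩ : ∃ l : Fin n, (j : ℕ) + 1 = l := ⟨⟨j + 1, by omega⟩, rfl⟩
  have hβl : β j = β l :=
    le_antisymm (hβ (by omega)) ((hβ (show l ≤ k by omega)).trans_eq hk)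
  have hupl := hup l
  exact ⟨j, l, hl, by omega, hβl, fun i hi =>
    (hβ hi.le).lt_of_ne fun h => hmin i ⟨j, hi, h.symm⟩ hi⟩

theorem rowBoundSet_update_of_eq {j l k' : Fin n} (hk : (k' : ℕ) + 1 = β j) (hjl : j < l)
    (hlam : lam j = lam l) (hβ : β j = β l) :
    rowBoundSet lam (Function.update β j k') = rowBoundSet lam β := by
  ext T
  rw [mem_rowBoundSet_update (by omega)]
  refine and_iff_left_of_imp fun hT c => ?_
  have hc : (c : ℕ) < lam l := hlam ▸ c.isLt
  have h1 : T j c < T l ⟨c, hc⟩ := hT.1.2 j l c c.isLt hc hjl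
  have h2 : T l ⟨c, hc⟩ ≤ β l := hT.2 l ⟨c, hc⟩
  omega

theorem det_gvMatrix_update_of_eq {j l k' : Fin n} (hk : (k' : ℕ) + 1 = β j) (hj : j < β j)
    (hjl : (j : ℕ) + 1 = l) (hlam : lam j = lam l) (hβ : β j = β l) :
    (gvMatrix lam (Function.update β j k')).det = (gvMatrix lam β).det := by
  have hne : l ≠ j := by omega
  have hzero : ((gvMatrix lam β).updateCol j
      (gvCol ((lam j : ℤ) - (j : ℤ) - 1) (β j))).det = 0 := by
    refine Matrix.det_zero_of_column_eq hne.symm fun i => ?_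
    rw [Matrix.updateCol_self, Matrix.updateCol_ne hne, gvMatrix_apply, hβ, hlam]
    congr 1
    omega
  rw [det_gvMatrix_eq_add lam β hk hj, hzero, mul_zero, add_zero]

/-- The flagged Jacobi–Trudi formula, by induction on the shape and the flag: both sides satisfy
the same recursion at the first repeated entry of the flag. -/
theorem det_gvMatrix_of_monotone (hlam : Antitone lam) (hβ : Monotone β) (hup : IsUpper β) :
    (gvMatrix lam β).det = rowBoundSum lam β := by
  obtain ⟨p, hp⟩ : ∃ p, p = (lam, β) := ⟨_, rfl⟩
  induction p using WellFoundedLT.induction generalizing lam β with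
  | ind p ih =>
  subst hp
  by_cases hid : β = id
  · rw [hid, det_gvMatrix_id, rowBoundSum_id hlam]
  obtain ⟨j, l, hjl, hjβ, hβl, hprev⟩ := exists_first_repetition hβ hup hid
  obtain ⟨k', hk⟩ : ∃ k' : Fin n, (k' : ℕ) + 1 = β j := ⟨⟨β j - 1, by omega⟩, by simp; omega⟩
  have ih_lower : (gvMatrix lam (Function.update β j k')).det =
      rowBoundSum lam (Function.update β j k') := by
    refine ih _ (Prod.mk_lt_mk_iff_right.2 (update_lt_self_iff.2 (by omega))) hlam ?_ ?_ rfl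
    · refine monotone_update hβ (fun i hi => ?_) fun i hi => ?_
      · have := hprev i hi
        omega
      · exact (by omega : k' ≤ β j).trans (hβ hi.le)
    · unfold IsUpper
      rw [Function.forall_update_iff β fun i b => i ≤ b]
      exact ⟨by omega, fun i _ => hup i⟩
  rcases (hlam (by omega : j ≤ l)).eq_or_lt with hrow | hrow
  · rw [← det_gvMatrix_update_of_eq hk hjβ hjl hrow.symm hβl, ih_lower,
      rowBoundSum_congr (rowBoundSet_update_of_eq hk (by omega) hrow.symm hβl)]
  · obtain ⟨m, hm⟩ : ∃ m, m + 1 = lam j := ⟨lam j - 1, by omega⟩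
    have hnext (i : Fin n) (hi : j < i) : lam i ≤ m := by
      have := hlam (by omega : l ≤ i)
      omega
    rw [det_gvMatrix_eq_add lam β hk hjβ, rowBoundSum_eq_add hk hm hnext hprev, ih_lower,
      show (lam j : ℤ) - (j : ℤ) - 1 = (m : ℤ) - j by omega, ← gvMatrix_update_left]
    congr 2
    refine ih _ (Prod.mk_lt_mk_iff_left.2 (update_lt_self_iff.2 (by omega))) ?_ hβ hup rfl
    exact (monotone_update hlam.dual_right (fun i hi => (by omega : m ≤ lam j).trans (hlam hi.le))
      hnext).dual_right

end FlaggedJacobiTrudi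

section Core
variable {lam : Fin n → ℕ} {β η : Fin n → Fin n}

theorem core_add (hβ : IsUpper β) {R : Set ℕ} {i k : Fin n} (hik : i ≤ k)
    (hk : k ≤ nextCritical R β i) :
    (core R β k : ℕ) + nextCritical R β i = platform R β i + k := by
  have h := excess_core (R := R) hβ k
  rw [nextCritical_eq_of_le_nextCritical hik hk] at h
  unfold excess at h
  unfold platform
  omega

theorem rowBoundSet_eq_core (hlam : Antitone lam) (hβ : IsUpper β)
    (hcore : core (dividers lam) β ≤ η) (hplatform : η ≤ platform (dividers lam) β) :
    rowBoundSet lam η = rowBoundSet lam (core (dividers lam) β) := by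
  ext T
  refine and_congr_right fun hT => ⟨fun h i c => ?_, fun h i c => (h i c).trans (hcore i)⟩
  have hix := le_nextCritical (dividers lam) β i
  have hc : (c : ℕ) < lam (nextCritical (dividers lam) β i) :=
    (sameCarrel_nextCritical (dividers lam) β i).lam_eq hlam ▸ c.isLt
  have hcol : (T i c : ℕ) + _ ≤ _ := hT.add_le_add hlam hix c.isLt hc
  have hbound := (h _ ⟨c, hc⟩).trans (hplatform _)
  have hconst : platform (dividers lam) β (nextCritical (dividers lam) β i) =
      platform (dividers lam) β i :=
    congrArg β (isCritical_nextCritical (dividers lam) β i).nextCritical_eq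
  have hci := core_add hβ le_rfl hix
  omega

theorem det_gvMatrix_update_eq_core (hlam : Antitone lam) (hβ : IsUpper β) {y k : Fin n}
    (hη : ∀ l, y < l → η l = core (dividers lam) β l) (hcore : core (dividers lam) β y ≤ k)
    (hplatform : k ≤ platform (dividers lam) β y) :
    (gvMatrix lam (Function.update η y k)).det =
      (gvMatrix lam (Function.update η y (core (dividers lam) β y))).det := by
  have hyx := le_nextCritical (dividers lam) β y
  have hs := sameCarrel_nextCritical (dividers lam) β y
  have hadd {l : Fin n} (hyl : y ≤ l) (hlx : l ≤ nextCritical (dividers lam) β y) :=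
    core_add hβ hyl hlx
  have hup : nextCritical (dividers lam) β y ≤ platform (dividers lam) β y := hβ _
  rw [gvMatrix_update_right, gvMatrix_update_right]
  generalize nextCritical (dividers lam) β y = x at hyx hs hadd hup
  have hcol : (lam y : ℤ) - (y : ℤ) = ((lam x : ℤ) - x) + (((x : ℕ) - (y : ℕ) : ℕ) : ℤ) := by
    rw [hs.lam_eq hlam]
    omega
  rw [hcol]
  refine det_updateCol_gvCol_eq (b := platform (dividers lam) β y) (by omega) ?_
    (by have := hadd le_rfl hyx; omega) hcore hplatform
  intro d hd
  obtain ⟨l, hl⟩ : ∃ l : Fin n, (l : ℕ) + d = x := ⟨⟨x - d, by omega⟩, by simp; omega⟩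
  have hyl : y < l := by omega
  have hlx : l ≤ x := by omega
  refine ⟨l, hyl.ne', core (dividers lam) β l, by have := hadd hyl.le hlx; omega, fun i => ?_⟩
  rw [gvMatrix_apply, hη l hyl, (hs.of_subinterval hyl.le hlx le_rfl).lam_eq hlam]
  congr 1
  omega

theorem det_gvMatrix_eq_core (hlam : Antitone lam) (hβ : IsUpper β)
    (hcore : core (dividers lam) β ≤ η) (hplatform : η ≤ platform (dividers lam) β) :
    (gvMatrix lam η).det = (gvMatrix lam (core (dividers lam) β)).det := by
  classical
  suffices h : ∀ s : Finset (Fin n), (gvMatrix lam (s.piecewise η (core (dividers lam) β))).det =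
      (gvMatrix lam (core (dividers lam) β)).det by
    rw [← h Finset.univ, Finset.piecewise_univ]
  intro s
  induction s using Finset.induction_on_max with
  | empty => rw [Finset.piecewise_empty]
  | insert y s hs ih =>
    have hy {l : Fin n} (hyl : y ≤ l) :
        s.piecewise η (core (dividers lam) β) l = core (dividers lam) β l :=
      Finset.piecewise_eq_of_notMem _ _ _ fun hl => (hs l hl).not_ge hyl
    rw [Finset.piecewise_insert, det_gvMatrix_update_eq_core hlam hβ (fun l hyl => hy hyl.le)
      (hcore y) (hplatform y), ← hy le_rfl, Function.update_eq_self, ih]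

theorem rowBoundSum_core (hlam : Antitone lam) (hb : IsBoundedByPlatform (dividers lam) β) :
    rowBoundSum lam (core (dividers lam) β) = rowBoundSum lam β :=
  rowBoundSum_congr (rowBoundSet_eq_core hlam hb.1 (core_le hb.1) hb.2).symm

theorem det_gvMatrix_eq_rowBoundSum (hlam : Antitone lam) (h : IsGaplessCore (dividers lam) β)
    (hb : IsBoundedByPlatform (dividers lam) β) : (gvMatrix lam β).det = rowBoundSum lam β := by
  have hp := core_le_platform (dividers lam) β
  calc
    (gvMatrix lam β).det = (gvMatrix lam (platform (dividers lam) β)).det := by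
      rw [det_gvMatrix_eq_core hlam h.1 (core_le h.1) hb.2, det_gvMatrix_eq_core hlam h.1 hp le_rfl]
    _ = rowBoundSum lam (platform (dividers lam) β) :=
      det_gvMatrix_of_monotone hlam h.monotone_platform fun i => (h.1 i).trans (hb.2 i)
    _ = rowBoundSum lam β := by
      rw [rowBoundSum_congr (rowBoundSet_eq_core hlam h.1 hp le_rfl), rowBoundSum_core hlam hb]

end Core

section LatticePath

theorem IsLatticePath.exists_time {A B : ℕ × ℕ} {p : List (ℕ × ℕ)} (hp : IsLatticePath A B p) :
    ∃ (f : ℕ → ℕ × ℕ) (t : ℕ), f 0 = A ∧ f t = B ∧ (∀ s ≤ t, f s ∈ p) ∧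
      ∀ s < t, Step (f s) (f (s + 1)) := by
  obtain ⟨hA, hB, hchain⟩ := hp
  have hlen : 0 < p.length := List.length_pos_iff.2 fun h => by simp [h] at hA
  have hget {s : ℕ} (hs : s ≤ p.length - 1) : p.getD s A = p[s] := List.getD_eq_getElem _ _ _
  refine ⟨fun s => p.getD s A, p.length - 1, ?_, ?_, fun s hs => ?_, fun s hs => ?_⟩
  · rw [List.head?_eq_getElem?] at hA
    exact (congrArg (Option.getD · A) hA :)
  · rw [List.getLast?_eq_getElem?] at hB
    exact (congrArg (Option.getD · A) hB :)
  · dsimp only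
    rw [hget hs]
    exact List.getElem_mem _
  · dsimp only
    rw [hget hs.le, hget hs]
    exact List.isChain_iff_getElem.1 hchain s (by omega)

theorem steps_mono {f : ℕ → ℕ × ℕ} {s t : ℕ} (h : ∀ r < t, Step (f r) (f (r + 1)))
    (hst : s ≤ t) : f s ≤ f t := by
  induction t, hst using Nat.le_induction with
  | base => exact le_rfl
  | succ t _ ih =>
    have hstep := h t t.lt_succ_self
    simp only [Step, Prod.ext_iff] at hstep
    refine (ih fun r hr => h r (hr.trans t.lt_succ_self)).trans (Prod.le_def.2 ?_)
    omega

theorem steps_fst_add_snd {f : ℕ → ℕ × ℕ} {t : ℕ} (h : ∀ r < t, Step (f r) (f (r + 1))) :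
    (f t).1 + (f t).2 = (f 0).1 + (f 0).2 + t := by
  induction t with
  | zero => rfl
  | succ t ih =>
    have := ih fun r hr => h r (hr.trans t.lt_succ_self)
    have hstep := h t t.lt_succ_self
    simp only [Step, Prod.ext_iff] at hstep
    omega

end LatticePath

/-- A family of disjoint lattice paths as walks in time: the `l`-th walk leaves the `σ l`-th source
at time `0` and stops at the `l`-th terminal at time `arrival l`. Only encounters at equal times are
excluded, which is all that disjointness amounts to, since the sources lie on an antidiagonal. -/
structure DisjointWalks (lam : Fin n → ℕ) (β : Fin n → Fin n) (σ : Equiv.Perm (Fin n)) where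
  pos : Fin n → ℕ → ℕ × ℕ
  arrival : Fin n → ℕ
  pos_zero : ∀ l, pos l 0 = source (σ l)
  pos_arrival : ∀ l, pos l (arrival l) = terminal lam β l
  step : ∀ l, ∀ s < arrival l, Step (pos l s) (pos l (s + 1))
  pos_ne : ∀ {l l' s}, l ≠ l' → s ≤ arrival l → s ≤ arrival l' → pos l s ≠ pos l' s

theorem nonempty_disjointWalks {lam : Fin n → ℕ} {β : Fin n → Fin n} {π : Equiv.Perm (Fin n)}
    (h : (disjointPaths lam β π).Nonempty) : Nonempty (DisjointWalks lam β π.symm) := by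
  obtain ⟨Λ, hΛ, hdisj⟩ := h
  choose f t hzero harrival hmem hstep using fun m => (hΛ m).exists_time
  exact ⟨{
    pos := fun l => f (π.symm l)
    arrival := fun l => t (π.symm l)
    pos_zero := fun l => hzero _
    pos_arrival := fun l => (harrival _).trans (by rw [Equiv.apply_symm_apply])
    step := fun l => hstep _
    pos_ne := fun hne hs hs' heq =>
      hdisj _ _ (π.symm.injective.ne hne) (hmem _ _ hs) (heq ▸ hmem _ _ hs') }⟩

namespace DisjointWalks
variable {lam : Fin n → ℕ} {β : Fin n → Fin n} {σ : Equiv.Perm (Fin n)}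
  (P : DisjointWalks lam β σ) {j l : Fin n} {s : ℕ}
include P

theorem fst_add_snd (hs : s ≤ P.arrival l) : (P.pos l s).1 + (P.pos l s).2 = n - 1 + s := by
  have := steps_fst_add_snd fun r (hr : r < s) => P.step l r (hr.trans_le hs)
  rw [P.pos_zero, source] at this
  omega

theorem pos_le_terminal (hs : s ≤ P.arrival l) : P.pos l s ≤ terminal lam β l :=
  P.pos_arrival l ▸ steps_mono (P.step l) hs

theorem arrival_eq (l : Fin n) : lam l + (n - 1 - (l : ℕ)) + β l = n - 1 + P.arrival l := by
  simpa only [P.pos_arrival, terminal] using P.fst_add_snd (l := l) le_rfl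

theorem injOn_fst {S : Set (Fin n)} (hs : ∀ l ∈ S, s ≤ P.arrival l) :
    S.InjOn fun l => (P.pos l s).1 := by
  intro l hl l' hl' heq
  by_contra hne
  have h := P.fst_add_snd (hs l hl)
  have h' := P.fst_add_snd (hs l' hl')
  dsimp only at heq
  exact P.pos_ne hne (hs l hl) (hs l' hl') (Prod.ext heq (by omega))

theorem fst_lt_fst (hjl : σ j < σ l) (hj : s ≤ P.arrival j) (hl : s ≤ P.arrival l) :
    (P.pos l s).1 < (P.pos j s).1 := by
  induction s with
  | zero =>
    rw [P.pos_zero, P.pos_zero]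
    dsimp only [source]
    omega
  | succ s ih =>
    have hlt := ih (by omega) (by omega)
    have hsumj := P.fst_add_snd hj
    have hsuml := P.fst_add_snd hl
    have hne := P.pos_ne (by rintro rfl; exact hjl.false) hj hl
    have hstepj := P.step j s hj
    have hstepl := P.step l s hl
    simp only [Step, ne_eq, Prod.ext_iff] at hne hstepj hstepl
    omega

theorem arrival_le_of_inversion (hlam : Antitone lam) (hlj : l < j) (hσ : σ j < σ l) :
    P.arrival j ≤ P.arrival l := by
  by_contra! h
  have horder := P.fst_lt_fst hσ h.le le_rfl
  have hend := (P.pos_le_terminal h.le).1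
  have := hlam hlj.le
  rw [P.pos_arrival] at horder
  dsimp only [terminal] at horder hend
  omega

theorem arrival_nextCritical_le (hlam : Antitone lam) (hjl : j ≤ l)
    (hl : l ≤ nextCritical (dividers lam) β j) :
    P.arrival (nextCritical (dividers lam) β j) ≤ P.arrival l := by
  have hs := sameCarrel_nextCritical (dividers lam) β j
  have hexcess := excess_nextCritical_le (β := β) hjl (hs.of_subinterval le_rfl hjl hl)
  have hrow := (hs.of_subinterval hjl hl le_rfl).lam_eq hlam
  have htime := P.arrival_eq l
  have htime_next := P.arrival_eq (nextCritical (dividers lam) β j)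
  unfold excess at hexcess
  omega

theorem le_fst_arrival {x : Fin n} (hβ : β l ≤ β x) (hl : P.arrival x ≤ P.arrival l) :
    lam x + (n - 1 - (x : ℕ)) ≤ (P.pos l (P.arrival x)).1 := by
  have htime := P.arrival_eq x
  have hsum := P.fst_add_snd hl
  have hsnd : (P.pos l (P.arrival x)).2 ≤ β l := (P.pos_le_terminal hl).2
  omega

end DisjointWalks

theorem exists_inversion {σ : Equiv.Perm (Fin n)} (h : σ ≠ 1) :
    ∃ l j, l < j ∧ σ j < σ l := by
  contrapose! h
  refine (Equiv.Perm.monotone_iff σ).1 fun a b hab => ?_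
  rcases hab.eq_or_lt with rfl | hlt
  exacts [le_rfl, h a b hlt]

theorem IsGaplessCore.le_apply_nextCritical {R : Set ℕ} {β : Fin n → Fin n}
    (h : IsGaplessCore R β) (hb : IsBoundedByPlatform R β) {j l : Fin n}
    (hl : l ≤ nextCritical R β j) : β l ≤ β (nextCritical R β j) :=
  calc
    β l ≤ platform R β l := hb.2 l
    _ ≤ platform R β (nextCritical R β j) := h.monotone_platform hl
    _ = β (nextCritical R β j) := congrArg β (isCritical_nextCritical R β j).nextCritical_eq

/-- For an inversion `l < j`, let `x` be the critical index after `j`. When the walk to the terminal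
`x` stops, the walks to `l` and to `j, …, x` are all under way, but there are only `x - j + 1`
places left for them. -/
theorem DisjointWalks.not_inversion {lam : Fin n → ℕ} {β : Fin n → Fin n}
    {σ : Equiv.Perm (Fin n)} (P : DisjointWalks lam β σ) (hlam : Antitone lam)
    (h : IsGaplessCore (dividers lam) β) (hb : IsBoundedByPlatform (dividers lam) β)
    {l j : Fin n} (hlj : l < j) : ¬ σ j < σ l := by
  intro hσ
  have hjx := le_nextCritical (dividers lam) β j
  have hrow := (sameCarrel_nextCritical (dividers lam) β j).lam_eq hlam
  have harrival {k : Fin n} := P.arrival_nextCritical_le (l := k) hlam (j := j)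
  have hdepth {k : Fin n} := h.le_apply_nextCritical hb (j := j) (l := k)
  generalize nextCritical (dividers lam) β j = x at *
  have hlate : ∀ k ∈ insert l (Finset.Icc j x), P.arrival x ≤ P.arrival k := by
    rw [Finset.forall_mem_insert]
    refine ⟨(harrival le_rfl hjx).trans (P.arrival_le_of_inversion hlam hlj hσ), fun k hk => ?_⟩
    exact harrival (Finset.mem_Icc.1 hk).1 (Finset.mem_Icc.1 hk).2
  have hright : ∀ k ∈ insert l (Finset.Icc j x),
      (P.pos k (P.arrival x)).1 ≤ lam j + (n - 1 - (j : ℕ)) := by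
    rw [Finset.forall_mem_insert]
    refine ⟨?_, fun k hk => ?_⟩
    · have hjx' := harrival le_rfl hjx
      exact (P.fst_lt_fst hσ hjx' (hlate l (Finset.mem_insert_self _ _))).le.trans
        (P.pos_le_terminal hjx').1
    · refine (P.pos_le_terminal (hlate k (Finset.mem_insert_of_mem hk))).1.trans ?_
      have hjk := (Finset.mem_Icc.1 hk).1
      have := hlam hjk
      dsimp only [terminal]
      omega
  have hleft : ∀ k ∈ insert l (Finset.Icc j x),
      lam x + (n - 1 - (x : ℕ)) ≤ (P.pos k (P.arrival x)).1 := fun k hk => by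
    have hkx : k ≤ x := by
      rcases Finset.mem_insert.1 hk with rfl | hk
      exacts [(hlj.trans_le hjx).le, (Finset.mem_Icc.1 hk).2]
    exact P.le_fst_arrival (hdepth hkx) (hlate k hk)
  have hcard := Finset.card_le_card_of_injOn _
    (fun k hk => Finset.mem_Icc.2 ⟨hleft k hk, hright k hk⟩) (P.injOn_fst hlate)
  rw [Finset.card_insert_of_notMem fun hl => (Finset.mem_Icc.1 hl).1.not_gt hlj, Nat.card_Icc,
    Fin.card_Icc] at hcard
  omega

theorem nonpermutable {lam : Fin n → ℕ} (hlam : Antitone lam) {β : Fin n → Fin n}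
    (h : IsGaplessCore (dividers lam) β) (hb : IsBoundedByPlatform (dividers lam) β) :
    Nonpermutable lam β := by
  refine fun π hπ => Set.not_nonempty_iff_eq_empty.1 fun hne => ?_
  obtain ⟨P⟩ := nonempty_disjointWalks hne
  obtain ⟨l, j, hlj, hσ⟩ := exists_inversion (inv_ne_one.2 hπ)
  exact P.not_inversion hlam h hb hlj hσ

section Key

variable {R : Set ℕ} {β : Fin n → Fin n} {i k x y : Fin n}

/-- The entry in row `i ≤ x` of a column of length `x + 1` of the largest tableau with row bounds
`β`, namely the minimum of `β k - (k - i)` over `i ≤ k ≤ x`.  The subtraction does not truncate when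
`β` is upper; for `i > x` the value is `β i`. -/
def keyEntry (β : Fin n → Fin n) (x i : Fin n) : Fin n :=
  (Finset.Icc i (max i x)).inf' (Finset.nonempty_Icc.2 (le_max_left i x)) fun k =>
    ⟨(β k : ℕ) - ((k : ℕ) - (i : ℕ)), (Nat.sub_le _ _).trans_lt (β k).isLt⟩

theorem excess_keyEntry_le (hβ : IsUpper β) (hik : i ≤ k) (hkx : k ≤ x) :
    excess (keyEntry β x) i ≤ excess β k := by
  have hmem : k ∈ Finset.Icc i (max i x) := Finset.mem_Icc.2 ⟨hik, hkx.trans (le_max_right i x)⟩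
  have hle : (keyEntry β x i : ℕ) ≤ β k - (k - i) :=
    Fin.le_def.1 (Finset.inf'_le (fun k : Fin n => Fin.mk _ _) hmem)
  have := hβ k
  unfold excess
  omega

theorem exists_excess_eq_excess_keyEntry (hβ : IsUpper β) (hix : i ≤ x) :
    ∃ k, i ≤ k ∧ k ≤ x ∧ excess β k = excess (keyEntry β x) i := by
  obtain ⟨k, hk, heq⟩ : ∃ k ∈ Finset.Icc i (max i x), keyEntry β x i = ⟨β k - (k - i), _⟩ :=
    Finset.exists_mem_eq_inf' _ _
  rw [max_eq_right hix, Finset.mem_Icc] at hk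
  have hval := congrArg Fin.val heq
  have := hβ k
  refine ⟨k, hk.1, hk.2, ?_⟩
  unfold excess
  dsimp only at hval
  omega

theorem keyEntry_le (hβ : IsUpper β) (hik : i ≤ k) (hkx : k ≤ x) : keyEntry β x i ≤ β k := by
  have := excess_keyEntry_le hβ hik hkx
  unfold excess at this
  omega

theorem strictMonoOn_keyEntry (hβ : IsUpper β) (x : Fin n) :
    StrictMonoOn (keyEntry β x) (Set.Iic x) := by
  intro i _ k hk hik
  obtain ⟨l, hkl, hlx, hl⟩ := exists_excess_eq_excess_keyEntry hβ hk
  have := excess_keyEntry_le hβ (hik.le.trans hkl) hlx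
  unfold excess at hl this
  omega

theorem keyEntry_antitone (hβ : IsUpper β) (hix : i ≤ x) (hxy : x ≤ y) :
    keyEntry β y i ≤ keyEntry β x i := by
  obtain ⟨k, hik, hkx, hk⟩ := exists_excess_eq_excess_keyEntry hβ hix
  have := excess_keyEntry_le hβ hik (hkx.trans hxy)
  unfold excess at hk this
  omega

/-- The set of entries of a column of length `x + 1` of the largest tableau with row bounds `β`. -/
def keySet (β : Fin n → Fin n) (x : Fin n) : Set (Fin n) := keyEntry β x '' Set.Iic x

theorem ncard_keySet (hβ : IsUpper β) (x : Fin n) : (keySet β x).ncard = x + 1 := by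
  rw [keySet, (strictMonoOn_keyEntry hβ x).injOn.ncard_image,
    Set.ncard_eq_toFinset_card', Set.toFinset_Iic, Fin.card_Iic]

/-- Below a gap of a key set there is a strict right-to-left minimum of the excess. -/
theorem exists_excess_lt_of_notMem_keySet (hβ : IsUpper β) {v : Fin n} (hix : i ≤ x)
    (hiv : keyEntry β x i < v) (hv : v ∉ keySet β x) :
    ∃ k, i ≤ k ∧ k ≤ x ∧ β k < v ∧ ∀ z, k < z → z ≤ x → excess β k < excess β z := by
  obtain ⟨k, hik, hk⟩ :=
    (Set.toFinite {k | k ≤ x ∧ keyEntry β x k < v}).exists_le_maximal ⟨hix, hiv⟩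
  have hlarge : ∀ z, k < z → z ≤ x → (v : ℤ) - k ≤ excess β z := by
    intro z hkz hzx
    have hsucc : (⟨k + 1, by omega⟩ : Fin n) ≤ z := Fin.le_def.2 hkz
    have hgt : v < keyEntry β x ⟨k + 1, by omega⟩ := by
      refine lt_of_le_of_ne (not_lt.1 fun hlt => ?_) fun heq => hv ⟨_, hsucc.trans hzx, heq.symm⟩
      exact absurd (Fin.le_def.1 (hk.le_of_ge ⟨hsucc.trans hzx, hlt⟩ (Fin.le_def.2 (by simp))))
        (by simp)
    have := excess_keyEntry_le hβ hsucc hzx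
    unfold excess at this ⊢
    dsimp only at this
    omega
  have hkv := hk.prop.2
  have hβk : β k = keyEntry β x k := by
    obtain ⟨l, hkl, hlx, hl⟩ := exists_excess_eq_excess_keyEntry hβ hk.prop.1
    rcases hkl.eq_or_lt with rfl | hkl
    · unfold excess at hl
      omega
    · have := hlarge l hkl hlx
      unfold excess at *
      omega
  refine ⟨k, hik, hk.prop.1, hβk ▸ hkv, fun z hkz hzx => ?_⟩
  have := hlarge z hkz hzx
  unfold excess at *
  omega

theorem IsCarrelEnd.isCritical_of_excess_lt (hx : IsCarrelEnd R x) (hkx : k ≤ x)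
    (h : ∀ z, k < z → z ≤ x → excess β k < excess β z) : IsCritical R β k :=
  isCritical_iff.2 fun z hkz hs => h z hkz ((hx.le_iff hs).1 hkx)

theorem IsGaplessCore.keyEntry_le_of_isCritical (h : IsGaplessCore R β) (hx : IsCarrelEnd R x)
    (hix : i ≤ x) (hxk : x ≤ k) (hk : IsCritical R β k) : keyEntry β x i ≤ β k := by
  have hle := h.monotone_platform hxk
  unfold platform at hle
  rw [hk.nextCritical_eq, (IsCritical.last x hx).nextCritical_eq] at hle
  exact (keyEntry_le h.1 hix le_rfl).trans hle

theorem IsGaplessCore.keySet_subset (h : IsGaplessCore R β) (hx : IsCarrelEnd R x)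
    (hy : IsCarrelEnd R y) (hxy : x ≤ y) : keySet β x ⊆ keySet β y := by
  rintro _ ⟨i, hix, rfl⟩
  by_contra hnot
  have hlt : keyEntry β y i < keyEntry β x i :=
    (keyEntry_antitone h.1 hix hxy).lt_of_ne fun heq => hnot ⟨i, hix.trans hxy, heq⟩
  obtain ⟨k, hik, hky, hβk, hmin⟩ :=
    exists_excess_lt_of_notMem_keySet h.1 (hix.trans hxy) hlt hnot
  refine hβk.not_ge ?_
  rcases le_total k x with hkx | hxk
  · exact keyEntry_le h.1 hik hkx
  · exact h.keyEntry_le_of_isCritical hx hix hxk (hy.isCritical_of_excess_lt hky hmin)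

theorem IsCarrelIncreasing.keyEntry_eq (h : IsCarrelIncreasing R β) (hβ : IsUpper β) (hix : i ≤ x)
    (hs : SameCarrel R i x) : keyEntry β x i = β i := by
  refine (keyEntry_le hβ le_rfl hix).antisymm ?_
  obtain ⟨k, hik, hkx, hk⟩ := exists_excess_eq_excess_keyEntry hβ hix
  have := h.excess_le hik (hs.of_subinterval le_rfl hik hkx)
  unfold excess at hk this
  omega

end Key

section Enumeration

variable {e g : Fin n → Fin n} {i x : Fin n}

theorem le_of_strictMonoOn_of_mapsTo (he : StrictMonoOn e (Set.Iic x))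
    (hg : StrictMonoOn g (Set.Iic i)) (h : Set.MapsTo g (Set.Iic i) (e '' Set.Iic x)) :
    e i ≤ g i := by
  obtain ⟨k, hkx, hk⟩ := h (Set.self_mem_Iic (a := i))
  have hsub : g '' Set.Iic i ⊆ e '' Set.Iic k := by
    rintro _ ⟨a, ha, rfl⟩
    obtain ⟨l, hlx, hl⟩ := h ha
    refine ⟨l, (he.le_iff_le hlx hkx).1 ?_, hl⟩
    rw [hl, hk]
    exact hg.monotoneOn ha Set.self_mem_Iic ha
  have hcard := (Set.ncard_le_ncard hsub).trans (Set.ncard_image_le (Set.toFinite _))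
  rw [hg.injOn.ncard_image] at hcard
  simp only [Set.ncard_eq_toFinset_card', Set.toFinset_Iic, Fin.card_Iic] at hcard
  have hik : i ≤ k := by omega
  rw [← hk]
  exact he.monotoneOn (hik.trans hkx) hkx hik

theorem eqOn_of_strictMonoOn_of_image_eq (he : StrictMonoOn e (Set.Iic x))
    (hg : StrictMonoOn g (Set.Iic x)) (h : e '' Set.Iic x = g '' Set.Iic x) :
    Set.EqOn e g (Set.Iic x) := by
  have hsub {i : Fin n} (hi : i ∈ Set.Iic x) : Set.Iic i ⊆ Set.Iic x := Set.Iic_subset_Iic.2 hi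
  refine fun i hi => le_antisymm ?_ ?_
  · exact le_of_strictMonoOn_of_mapsTo he (hg.mono (hsub hi))
      (h ▸ (Set.mapsTo_image g _).mono_left (hsub hi))
  · exact le_of_strictMonoOn_of_mapsTo hg (he.mono (hsub hi))
      (h ▸ (Set.mapsTo_image e _).mono_left (hsub hi))

theorem IsGapless.eq_of_keySet_eq {R : Set ℕ} {β β' : Fin n → Fin n} (hβ : IsGapless R β)
    (hβ' : IsGapless R β') (h : ∀ x, IsCarrelEnd R x → keySet β x = keySet β' x) : β = β' := by
  funext i
  obtain ⟨x, hix, hs, hx⟩ := exists_isCarrelEnd R i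
  rw [← hβ.2.keyEntry_eq hβ.1.1 hix hs, ← hβ'.2.keyEntry_eq hβ'.1.1 hix hs]
  exact eqOn_of_strictMonoOn_of_image_eq (strictMonoOn_keyEntry hβ.1.1 x)
    (strictMonoOn_keyEntry hβ'.1.1 x) (h x hx) hix

end Enumeration

section Permutation

variable {R : Set ℕ} {π π' : Equiv.Perm (Fin n)} {i k x y : Fin n}

theorem exists_isCarrelEnd_of_not_sameCarrel (hik : i ≤ k) (h : ¬ SameCarrel R i k) :
    ∃ x, IsCarrelEnd R x ∧ i ≤ x ∧ x < k := by
  unfold SameCarrel at h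
  push Not at h
  obtain ⟨q, hq, hsep⟩ := h
  refine ⟨⟨q - 1, by omega⟩, .inl ?_, Fin.le_def.2 ?_, Fin.lt_def.2 ?_⟩
  · rwa [Nat.sub_add_cancel (by omega)]
  all_goals
    dsimp only
    omega

theorem IsRPermutation.eq_of_image_eq (hπ : IsRPermutation R π) (hπ' : IsRPermutation R π')
    (h : ∀ x, IsCarrelEnd R x → π '' Set.Iic x = π' '' Set.Iic x) : π = π' := by
  have hend {x : Fin n} (hx : IsCarrelEnd R x) (i : Fin n) : π'.symm (π i) ≤ x ↔ i ≤ x := by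
    rw [← Set.mem_Iic, ← Set.mem_Iic, ← π'.injective.mem_set_image, ← h x hx,
      Equiv.apply_symm_apply, π.injective.mem_set_image]
  have hmono : StrictMono (π'.symm ∘ π) := by
    intro i k hik
    by_contra! hle
    have hlt : π'.symm (π k) < π'.symm (π i) :=
      hle.lt_of_ne fun heq => hik.ne (π.injective (π'.symm.injective heq)).symm
    have hs : SameCarrel R i k := by
      by_contra hs
      obtain ⟨x, hx, hix, hxk⟩ := exists_isCarrelEnd_of_not_sameCarrel hik.le hs
      exact hxk.not_ge ((hend hx k).1 (hle.trans ((hend hx i).2 hix)))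
    have hs' : SameCarrel R (π'.symm (π k)) (π'.symm (π i)) := by
      by_contra hs'
      obtain ⟨x, hx, hkx, hxi⟩ := exists_isCarrelEnd_of_not_sameCarrel hle hs'
      exact hxi.not_ge ((hend hx i).2 (hik.le.trans ((hend hx k).1 hkx)))
    have := hπ' _ _ hlt hs'
    rw [Equiv.apply_symm_apply, Equiv.apply_symm_apply] at this
    exact this.not_gt (hπ i k hik hs)
  have hid : π'.symm ∘ π = id := (hmono.range_inj strictMono_id).1
    (by rw [(π'.symm.surjective.comp π.surjective).range_eq, Set.range_id])
  exact Equiv.ext fun i => π'.symm_apply_eq.1 (congrFun hid i)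

theorem exists_isCarrelEnd_le_iff_mem {K : Fin n → Set (Fin n)}
    (hmono : ∀ x y, IsCarrelEnd R x → IsCarrelEnd R y → x ≤ y → K x ⊆ K y)
    (hcard : ∀ x, IsCarrelEnd R x → (K x).ncard = x + 1) (v : Fin n) :
    ∃ l, IsCarrelEnd R l ∧ ∀ x, IsCarrelEnd R x → (l ≤ x ↔ v ∈ K x) := by
  have hexists : ∃ x, IsCarrelEnd R x ∧ v ∈ K x := by
    obtain ⟨l, -, -, hl⟩ := exists_isCarrelEnd ∅ v
    have hln := hl.resolve_left (Set.notMem_empty _)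
    have huniv : K l = Set.univ := by
      rw [Set.eq_univ_iff_ncard, hcard l (.inr hln), hln, Nat.card_fin]
    exact ⟨l, .inr hln, huniv ▸ Set.mem_univ v⟩
  obtain ⟨l, hl⟩ := (Set.toFinite {x | IsCarrelEnd R x ∧ v ∈ K x}).exists_minimal hexists
  refine ⟨l, hl.prop.1, fun x hx => ⟨fun hlx => hmono l x hl.prop.1 hx hlx hl.prop.2, fun hv => ?_⟩⟩
  exact (le_total l x).elim id fun hxl => hl.le_of_le ⟨hx, hv⟩ hxl

theorem exists_isRPermutation_image_eq {K : Fin n → Set (Fin n)}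
    (hmono : ∀ x y, IsCarrelEnd R x → IsCarrelEnd R y → x ≤ y → K x ⊆ K y)
    (hcard : ∀ x, IsCarrelEnd R x → (K x).ncard = x + 1) :
    ∃ π : Equiv.Perm (Fin n), IsRPermutation R π ∧
      ∀ x, IsCarrelEnd R x → π '' Set.Iic x = K x := by
  classical
  choose level hlevel hlevel_le using exists_isCarrelEnd_le_iff_mem hmono hcard
  -- `π` lists the values by their level, and in increasing order within each level.
  let π := Tuple.sort fun v => toLex (level v, v)
  have hsort : StrictMono ((fun v => toLex (level v, v)) ∘ π) :=
    (Tuple.monotone_sort _).strictMono_of_injective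
      (Function.Injective.comp (fun v w h => congrArg (fun p => (ofLex p).2) h) π.injective)
  have hlevel_mono : Monotone (level ∘ π) := fun i k hik =>
    Prod.Lex.monotone_fst _ _ (hsort.monotone hik)
  have hmem (x : Fin n) (hx : IsCarrelEnd R x) (i : Fin n) : π i ∈ K x ↔ i ≤ x := by
    have hpreimage : (Finset.univ.filter fun i => (level ∘ π) i ≤ x).card = x + 1 := by
      rw [← hcard x hx, Set.ncard_eq_toFinset_card']
      exact Finset.card_equiv π fun i => by simp [hlevel_le _ x hx]
    have hlt := Tuple.lt_card_le_iff_apply_le_of_monotone (j := i) (a := x) hlevel_mono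
    rw [hpreimage, Function.comp_apply, hlevel_le _ x hx] at hlt
    exact hlt.symm.trans Nat.lt_add_one_iff
  refine ⟨π, fun i k hik hs => ?_, fun x hx => Set.Subset.antisymm ?_ fun v hv => ?_⟩
  · have hle : level (π k) ≤ level (π i) := by
      have hl := hlevel (π i)
      have hil := (hmem _ hl i).1 ((hlevel_le _ _ hl).1 le_rfl)
      exact (hlevel_le _ _ hl).2 ((hmem _ hl k).2 ((hl.le_iff hs).1 hil))
    rcases Prod.Lex.toLex_lt_toLex.1 (hsort hik) with hlt | hlt
    · exact absurd hlt hle.not_gt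
    · exact hlt.2
  · exact Set.image_subset_iff.2 fun i hi => (hmem x hx i).2 hi
  · exact ⟨π.symm v, (hmem x hx _).1 (by simpa using hv), π.apply_symm_apply v⟩

theorem contains312_iff : Contains312 R π ↔ ∃ x y, IsCarrelEnd R x ∧ IsCarrelEnd R y ∧
    ∃ a b c, a ≤ x ∧ x < b ∧ b ≤ y ∧ y < c ∧ π b < π c ∧ π c < π a := by
  constructor
  · rintro ⟨q, hq, q', hq', a, b, c, ha, hb, hb', hc, hbc, hca⟩
    refine ⟨⟨q - 1, by omega⟩, ⟨q' - 1, by omega⟩, .inl ?_, .inl ?_, a, b, c, ?_⟩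
    · rwa [Nat.sub_add_cancel (by omega)]
    · rwa [Nat.sub_add_cancel (by omega)]
    · simp only [Fin.le_def, Fin.lt_def] at *
      omega
  · rintro ⟨x, y, hx, hy, a, b, c, ha, hb, hb', hc, hbc, hca⟩
    exact ⟨x + 1, hx.resolve_right (by omega), y + 1, hy.resolve_right (by omega), a, b, c,
      by omega, by omega, by omega, by omega, hbc, hca⟩

/-- For each carrel end `x`, the first entries of `π`, up to index `x`, form the key set of `β`. -/
def IsKeyPermutation (R : Set ℕ) (β : Fin n → Fin n) (π : Equiv.Perm (Fin n)) : Prop :=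
  ∀ x, IsCarrelEnd R x → π '' Set.Iic x = keySet β x

theorem IsKeyPermutation.apply_mem_keySet_iff {β : Fin n → Fin n} (h : IsKeyPermutation R β π)
    (hx : IsCarrelEnd R x) : π i ∈ keySet β x ↔ i ≤ x := by
  rw [← h x hx, π.injective.mem_set_image, Set.mem_Iic]

theorem IsGaplessCore.exists_isKeyPermutation {β : Fin n → Fin n} (h : IsGaplessCore R β) :
    ∃ π, IsRPermutation R π ∧ IsKeyPermutation R β π :=
  exists_isRPermutation_image_eq (fun _ _ hx hy => h.keySet_subset hx hy)
    fun x _ => ncard_keySet h.1 x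

theorem IsKeyPermutation.not_contains312 {β : Fin n → Fin n} (hβ : IsGaplessCore R β)
    (h : IsKeyPermutation R β π) : ¬ Contains312 R π := by
  rw [contains312_iff]
  rintro ⟨x, y, hx, hy, a, b, c, ha, hxb, hby, hc, hbc, hca⟩
  obtain ⟨l, hl, hla⟩ := (h.apply_mem_keySet_iff hx).2 ha
  obtain ⟨i, hi, hib⟩ := (h.apply_mem_keySet_iff hy).2 hby
  have hb : π b ∉ keySet β x := mt (h.apply_mem_keySet_iff hx).1 hxb.not_ge
  have hc : π c ∉ keySet β y := mt (h.apply_mem_keySet_iff hy).1 hc.not_ge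
  obtain ⟨k, hik, hky, hβk, hmin⟩ :=
    exists_excess_lt_of_notMem_keySet hβ.1 hi (hib ▸ hbc) hc
  rcases lt_or_ge x k with hxk | hkx
  · have := hβ.keyEntry_le_of_isCritical hx hl hxk.le (hy.isCritical_of_excess_lt hky hmin)
    exact (hβk.trans hca).not_ge (hla ▸ this)
  -- The minimum defining `keyEntry β y i` is attained at an index `≤ k ≤ x`, so that
  -- `keyEntry β x i` has the same value.
  obtain ⟨m, him, hmy, hm⟩ := exists_excess_eq_excess_keyEntry hβ.1 hi
  have hmk : m ≤ k := by
    by_contra! hkm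
    exact (hmin m hkm hmy).not_ge (hm ▸ excess_keyEntry_le hβ.1 hik hky)
  have hle := excess_keyEntry_le hβ.1 him (hmk.trans hkx)
  refine hb ⟨i, hik.trans hkx, hib ▸ ((keyEntry_antitone hβ.1 (hik.trans hkx)
    ((hxb.trans_le hby).le)).antisymm' ?_)⟩
  unfold excess at hle hm
  omega

end Permutation

section CarrelEnd

variable {R : Set ℕ} {i k x : Fin n}

/-- The last index of the carrel of `i`. -/
noncomputable def carrelEnd (R : Set ℕ) (i : Fin n) : Fin n := (exists_isCarrelEnd R i).choose

theorem le_carrelEnd (R : Set ℕ) (i : Fin n) : i ≤ carrelEnd R i :=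
  (exists_isCarrelEnd R i).choose_spec.1

theorem sameCarrel_carrelEnd (R : Set ℕ) (i : Fin n) : SameCarrel R i (carrelEnd R i) :=
  (exists_isCarrelEnd R i).choose_spec.2.1

theorem isCarrelEnd_carrelEnd (R : Set ℕ) (i : Fin n) : IsCarrelEnd R (carrelEnd R i) :=
  (exists_isCarrelEnd R i).choose_spec.2.2

theorem IsCarrelEnd.carrelEnd_le (hx : IsCarrelEnd R x) (hix : i ≤ x) : carrelEnd R i ≤ x :=
  (hx.le_iff (sameCarrel_carrelEnd R i)).1 hix

theorem IsCarrelEnd.carrelEnd_eq (hx : IsCarrelEnd R x) : carrelEnd R x = x :=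
  (hx.carrelEnd_le le_rfl).antisymm (le_carrelEnd R x)

theorem SameCarrel.carrelEnd_eq (h : SameCarrel R i k) : carrelEnd R i = carrelEnd R k :=
  le_antisymm
    ((isCarrelEnd_carrelEnd R k).carrelEnd_le
      (((isCarrelEnd_carrelEnd R k).le_iff h).2 (le_carrelEnd R k)))
    ((isCarrelEnd_carrelEnd R i).carrelEnd_le
      (((isCarrelEnd_carrelEnd R i).le_iff h).1 (le_carrelEnd R i)))

end CarrelEnd

section RankTuple

variable {R : Set ℕ} {π : Equiv.Perm (Fin n)} {i k x y : Fin n}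

/-- The entry at index `i ≤ x` of the increasing rearrangement of the entries of `π` up to index
`x`; for `i > x` the value is irrelevant. -/
def sortedPrefix (π : Equiv.Perm (Fin n)) (x i : Fin n) : Fin n :=
  if h : i ≤ x then
    ((Finset.Iic x).map π.toEmbedding).orderEmbOfFin
      ((Finset.card_map _).trans (Fin.card_Iic x)) ⟨i, Nat.lt_succ_of_le h⟩
  else i

theorem strictMonoOn_sortedPrefix (π : Equiv.Perm (Fin n)) (x : Fin n) :
    StrictMonoOn (sortedPrefix π x) (Set.Iic x) := by
  intro i hi k hk hik
  rw [sortedPrefix, sortedPrefix, dif_pos (Set.mem_Iic.1 hi), dif_pos (Set.mem_Iic.1 hk),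
    OrderEmbedding.lt_iff_lt]
  exact hik

theorem image_sortedPrefix (π : Equiv.Perm (Fin n)) (x : Fin n) :
    sortedPrefix π x '' Set.Iic x = π '' Set.Iic x := by
  have hrange := Finset.range_orderEmbOfFin ((Finset.Iic x).map π.toEmbedding)
    ((Finset.card_map _).trans (Fin.card_Iic x))
  rw [Finset.coe_map, Finset.coe_Iic, Equiv.coe_toEmbedding] at hrange
  rw [← hrange]
  refine Set.Subset.antisymm ?_ ?_
  · rintro _ ⟨i, hi, rfl⟩
    rw [sortedPrefix, dif_pos (Set.mem_Iic.1 hi)]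
    exact Set.mem_range_self _
  · rintro _ ⟨j, rfl⟩
    have hjx : (⟨j, by omega⟩ : Fin n) ≤ x := Fin.le_def.2 (by dsimp only; omega)
    exact ⟨_, hjx, dif_pos hjx⟩

theorem mapsTo_sortedPrefix (π : Equiv.Perm (Fin n)) (hix : i ≤ x) (hxy : x ≤ y) :
    Set.MapsTo (sortedPrefix π x) (Set.Iic i) (sortedPrefix π y '' Set.Iic y) := by
  rw [image_sortedPrefix]
  intro a ha
  refine Set.image_mono (Set.Iic_subset_Iic.2 hxy) ?_
  rw [← image_sortedPrefix]
  exact Set.mem_image_of_mem _ (ha.trans hix)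

theorem sortedPrefix_antitone (π : Equiv.Perm (Fin n)) (hix : i ≤ x) (hxy : x ≤ y) :
    sortedPrefix π y i ≤ sortedPrefix π x i :=
  le_of_strictMonoOn_of_mapsTo (strictMonoOn_sortedPrefix π y)
    ((strictMonoOn_sortedPrefix π x).mono (Set.Iic_subset_Iic.2 hix))
    (mapsTo_sortedPrefix π hix hxy)

theorem excess_sortedPrefix_le (π : Equiv.Perm (Fin n)) (hik : i ≤ k) (hkx : k ≤ x) :
    excess (sortedPrefix π x) i ≤ excess (sortedPrefix π x) k :=
  excess_le_excess_of_strictMonoOn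
    ((strictMonoOn_sortedPrefix π x).mono fun _ ha => ha.2.trans hkx) hik

theorem succ_sortedPrefix_notMem_image {v : Fin n} (hkx : k ≤ x)
    (hv : (v : ℕ) = sortedPrefix π x k + 1)
    (hk : ∀ z, k < z → z ≤ x → excess (sortedPrefix π x) k < excess (sortedPrefix π x) z) :
    v ∉ sortedPrefix π x '' Set.Iic x := by
  rintro ⟨z, hz, rfl⟩
  have hkz : k < z := ((strictMonoOn_sortedPrefix π x).lt_iff_lt hkx hz).1 (by omega)
  have := hk z hkz hz
  unfold excess at this
  omega

/-- Otherwise the least value missing above `sortedPrefix π y k`, an entry of the shorter prefix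
above it, and an entry of the longer prefix alone below it would form a pattern 312. -/
theorem sortedPrefix_le_of_not_contains312 (h312 : ¬ Contains312 R π) (hx : IsCarrelEnd R x)
    (hy : IsCarrelEnd R y) (hix : i ≤ x) (hxy : x ≤ y) (hik : i ≤ k) (hky : k ≤ y)
    (hk : ∀ z, k < z → z ≤ y → excess (sortedPrefix π y) k < excess (sortedPrefix π y) z) :
    sortedPrefix π x i ≤ sortedPrefix π y k := by
  have hmono := (strictMonoOn_sortedPrefix π y).monotoneOn
  by_contra! hlt
  let c : Fin n := ⟨sortedPrefix π y k + 1, by omega⟩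
  have hc : c ∉ π '' Set.Iic y :=
    image_sortedPrefix π y ▸ succ_sortedPrefix_notMem_image hky rfl hk
  obtain ⟨a, ha, hae⟩ : sortedPrefix π x i ∈ π '' Set.Iic x :=
    image_sortedPrefix π x ▸ Set.mem_image_of_mem _ hix
  obtain ⟨z, hzi, hz⟩ : ∃ z ≤ i, sortedPrefix π y z ∉ π '' Set.Iic x := by
    by_contra! hall
    have hle : sortedPrefix π x i ≤ sortedPrefix π y i :=
      le_of_strictMonoOn_of_mapsTo (strictMonoOn_sortedPrefix π x)
        ((strictMonoOn_sortedPrefix π y).mono (Set.Iic_subset_Iic.2 (hix.trans hxy)))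
        (image_sortedPrefix π x ▸ hall)
    exact hlt.not_ge (hle.trans (hmono (hix.trans hxy) hky hik))
  have hzy : z ≤ y := hzi.trans (hix.trans hxy)
  obtain ⟨b, hb, hbe⟩ : sortedPrefix π y z ∈ π '' Set.Iic y :=
    image_sortedPrefix π y ▸ Set.mem_image_of_mem _ hzy
  have hac : π a ≠ c := fun h => hc (h ▸ Set.mem_image_of_mem _ (ha.trans hxy))
  refine h312 (contains312_iff.2 ⟨x, y, hx, hy, a, b, π.symm c, ha, ?_, hb, ?_, ?_, ?_⟩)
  · exact not_le.1 fun hbx => hz (hbe ▸ Set.mem_image_of_mem _ hbx)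
  · exact not_le.1 fun hcy => hc ⟨_, hcy, π.apply_symm_apply c⟩
  · rw [π.apply_symm_apply, hbe]
    exact Fin.lt_def.2 (Nat.lt_succ_of_le (hmono hzy hky (hzi.trans hik)))
  · rw [π.apply_symm_apply]
    refine lt_of_le_of_ne (Fin.le_def.2 ?_) hac.symm
    rw [hae]
    exact hlt

/-- The rank tuple of `π`: its entries in a carrel are the last ones of the increasing
rearrangement of the entries of `π` up to the end of the carrel. -/
noncomputable def rankTuple (R : Set ℕ) (π : Equiv.Perm (Fin n)) (i : Fin n) : Fin n :=
  sortedPrefix π (carrelEnd R i) i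

theorem SameCarrel.rankTuple_eq (h : SameCarrel R i k) :
    rankTuple R π k = sortedPrefix π (carrelEnd R i) k := by
  rw [rankTuple, h.carrelEnd_eq]

theorem isUpper_rankTuple (R : Set ℕ) (π : Equiv.Perm (Fin n)) : IsUpper (rankTuple R π) := by
  intro i
  have hle := excess_sortedPrefix_le π (i := ⟨0, i.pos⟩) (Fin.le_def.2 (Nat.zero_le _))
    (le_carrelEnd R i)
  unfold excess at hle
  unfold rankTuple
  dsimp only at hle
  omega

theorem isCarrelIncreasing_rankTuple (R : Set ℕ) (π : Equiv.Perm (Fin n)) :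
    IsCarrelIncreasing R (rankTuple R π) := by
  intro i k hik hs
  rw [rankTuple, hs.rankTuple_eq]
  have hk := ((isCarrelEnd_carrelEnd R i).le_iff hs).1 (le_carrelEnd R i)
  exact strictMonoOn_sortedPrefix π _ (hik.le.trans hk) hk hik

theorem hasFlagCriticalList_rankTuple (h312 : ¬ Contains312 R π) :
    HasFlagCriticalList R (rankTuple R π) := by
  intro i j hi hij
  have hend : IsCarrelEnd R i := .inl hi
  set k := nextCritical R (rankTuple R π) j
  have hjk : j ≤ k := le_nextCritical R _ j
  have hik : i ≤ k := by omega
  have hk : k ≤ carrelEnd R k := le_carrelEnd R k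
  rw [rankTuple, hend.carrelEnd_eq, rankTuple]
  refine sortedPrefix_le_of_not_contains312 h312 hend (isCarrelEnd_carrelEnd R k) le_rfl
    (hik.trans hk) hik hk fun z hkz hz => ?_
  have hs : SameCarrel R k z := (sameCarrel_carrelEnd R k).of_subinterval le_rfl hkz.le hz
  have := (isCritical_nextCritical R (rankTuple R π) j).excess_lt z hkz hs
  unfold excess at this ⊢
  rwa [hs.rankTuple_eq] at this

theorem isGapless_rankTuple (h312 : ¬ Contains312 R π) : IsGapless R (rankTuple R π) :=
  ⟨⟨isUpper_rankTuple R π, hasFlagCriticalList_rankTuple h312⟩, isCarrelIncreasing_rankTuple R π⟩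

theorem keyEntry_rankTuple (h312 : ¬ Contains312 R π) (hx : IsCarrelEnd R x) (hix : i ≤ x) :
    keyEntry (rankTuple R π) x i = sortedPrefix π x i := by
  have hupper := isUpper_rankTuple R π
  apply le_antisymm
  · -- The last index `k` up to which the entries `i, i + 1, …` of the prefix are consecutive.
    obtain ⟨k, hik, hk⟩ := (Set.toFinite {k | k ≤ x ∧ i ≤ k ∧
      excess (sortedPrefix π x) k = excess (sortedPrefix π x) i}).exists_le_maximal
      ⟨hix, le_rfl, rfl⟩
    obtain ⟨hkx, -, hki⟩ := hk.prop
    have hrank : rankTuple R π k ≤ sortedPrefix π x k := by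
      refine sortedPrefix_le_of_not_contains312 h312 (isCarrelEnd_carrelEnd R k) hx
        (le_carrelEnd R k) (hx.carrelEnd_le hkx) le_rfl hkx fun z hkz hzx => ?_
      refine (excess_sortedPrefix_le π hkz.le hzx).lt_of_ne fun heq => ?_
      exact hkz.not_ge (hk.le_of_ge ⟨hzx, hik.trans hkz.le, heq.symm.trans hki⟩ hkz.le)
    have := excess_keyEntry_le hupper hik hkx
    unfold excess at this hki
    omega
  · obtain ⟨k, hik, hkx, hk⟩ := exists_excess_eq_excess_keyEntry hupper hix
    have hrank : sortedPrefix π x k ≤ rankTuple R π k :=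
      sortedPrefix_antitone π (le_carrelEnd R k) (hx.carrelEnd_le hkx)
    have := excess_sortedPrefix_le π hik hkx
    unfold excess at this hk
    omega

theorem isKeyPermutation_rankTuple (h312 : ¬ Contains312 R π) :
    IsKeyPermutation R (rankTuple R π) π := by
  intro x hx
  rw [← image_sortedPrefix]
  exact (Set.image_congr fun _ hi => keyEntry_rankTuple h312 hx hi).symm

/-- Each gapless tuple is the rank tuple of its key permutation. -/
theorem ncard_isGapless (R : Set ℕ) :
    {β : Fin n → Fin n | IsGapless R β}.ncard = parabolicCatalan n R := by
  symm
  refine Set.ncard_congr (fun π _ => rankTuple R π) (fun π hπ => isGapless_rankTuple hπ.2) ?_ ?_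
  · intro π π' hπ hπ' heq
    refine hπ.1.eq_of_image_eq hπ'.1 fun x hx => ?_
    rw [isKeyPermutation_rankTuple hπ.2 x hx, isKeyPermutation_rankTuple hπ'.2 x hx, heq]
  · intro β hβ
    obtain ⟨π, hπ, hkey⟩ := hβ.1.exists_isKeyPermutation
    have h312 := hkey.not_contains312 hβ.1
    exact ⟨π, ⟨hπ, h312⟩, (isGapless_rankTuple h312).eq_of_keySet_eq hβ fun x hx =>
      (isKeyPermutation_rankTuple h312 x hx).symm.trans (hkey x hx)⟩

end RankTuple

section Content

variable {lam : Fin n → ℕ} {β : Fin n → Fin n} {T : Filling lam}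

/-- The content of a filling: the exponent of its monomial. -/
noncomputable def content (T : Filling lam) : Fin n →₀ ℕ :=
  ∑ p : (i : Fin n) × Fin (lam i), Finsupp.single (T p.1 p.2) 1

theorem prod_X_eq_monomial_content (T : Filling lam) :
    ∏ i, ∏ c, (X (T i c) : MvPolynomial (Fin n) ℤ) = monomial (content T) 1 := by
  rw [content, monomial_sum_one, Fintype.prod_sigma]
  rfl

theorem coeff_rowBoundSum_ne_zero {d : Fin n →₀ ℕ} :
    coeff d (rowBoundSum lam β) ≠ 0 ↔ ∃ T ∈ rowBoundSet lam β, content T = d := by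
  classical
  simp only [rowBoundSum, coeff_sum, prod_X_eq_monomial_content, coeff_monomial]
  rw [Finset.sum_boole, Nat.cast_ne_zero, Finset.card_ne_zero, Finset.filter_filter,
    Finset.filter_nonempty_iff]
  simp only [Finset.mem_univ, true_and]

theorem content_apply (T : Filling lam) (v : Fin n) :
    content T v = {p : (i : Fin n) × Fin (lam i) | T p.1 p.2 = v}.ncard := by
  classical
  rw [Set.ncard_eq_toFinset_card', Set.toFinset_ofPred, Finset.card_filter, content,
    Finsupp.finsetSum_apply]
  simp only [Finsupp.single_apply]

/-- The set of columns of a filling that contain the value `v`. -/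
def columnsWith (T : Filling lam) (v : Fin n) : Set ℕ :=
  (fun p : (i : Fin n) × Fin (lam i) => (p.2 : ℕ)) '' {p | T p.1 p.2 = v}

theorem IsSemistandard.ncard_columnsWith (hT : IsSemistandard lam T) (v : Fin n) :
    (columnsWith T v).ncard = content T v := by
  rw [content_apply, columnsWith]
  refine Set.InjOn.ncard_image ?_
  rintro ⟨i, c, hc⟩ hi ⟨i', c', hc'⟩ hi' hcc
  obtain rfl : c = c' := hcc
  have heq : T i ⟨c, hc⟩ = T i' ⟨c, hc'⟩ := hi.trans hi'.symm
  rcases lt_trichotomy i i' with hlt | rfl | hlt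
  · exact absurd heq (hT.2 i i' c hc hc' hlt).ne
  · rfl
  · exact absurd heq (hT.2 i' i c hc' hc hlt).ne'

theorem strictMono_weight_content :
    StrictMono fun T : Filling lam => Finsupp.weight (fun v : Fin n => (v : ℕ)) (content T) := by
  have hweight (T : Filling lam) : Finsupp.weight (fun v : Fin n => (v : ℕ)) (content T) =
      ∑ p : (i : Fin n) × Fin (lam i), (T p.1 p.2 : ℕ) := by
    simp only [content, map_sum, Finsupp.weight_single, one_smul]
  intro T T' h
  obtain ⟨hle, i, hi⟩ := Pi.lt_def.1 h
  obtain ⟨-, c, hc⟩ := Pi.lt_def.1 hi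
  simp only [hweight]
  exact Finset.sum_lt_sum (fun p _ => hle p.1 p.2) ⟨⟨i, c⟩, Finset.mem_univ _, hc⟩

end Content

section MaxTableau

variable {lam : Fin n → ℕ} {β β' : Fin n → Fin n} {i k : Fin n}

/-- The last row that meets the column `c`. -/
def lastRow (c : Fin (lam i)) : Fin n :=
  ⟨colLength lam c - 1, by
    have := i.pos
    have : colLength lam c ≤ n := (Finset.card_filter_le _ _).trans_eq (Finset.card_fin n)
    omega⟩

theorem lastRow_add_one (hlam : Antitone lam) (c : Fin (lam i)) :
    (lastRow c : ℕ) + 1 = colLength lam c :=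
  Nat.sub_add_cancel (Nat.zero_lt_of_lt ((lt_colLength_iff hlam i c).2 c.isLt))

theorem le_lastRow_iff (hlam : Antitone lam) {c : Fin (lam i)} : k ≤ lastRow c ↔ c < lam k := by
  rw [← lt_colLength_iff hlam, ← lastRow_add_one hlam c]
  omega

theorem le_lastRow (hlam : Antitone lam) (c : Fin (lam i)) : i ≤ lastRow c :=
  (le_lastRow_iff hlam).2 c.isLt

theorem isCarrelEnd_lastRow (hlam : Antitone lam) (c : Fin (lam i)) :
    IsCarrelEnd (dividers lam) (lastRow c) := by
  have hsucc := lastRow_add_one hlam c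
  rcases (Nat.succ_le_of_lt (lastRow c).isLt).eq_or_lt with heq | hlt
  · exact .inr heq
  · exact .inl ⟨hlt, c, ⟨i, c.isLt⟩, hsucc⟩

/-- The largest tableau of shape `lam` with row bounds `β`. -/
def maxTableau (lam : Fin n → ℕ) (β : Fin n → Fin n) : Filling lam :=
  fun i c => keyEntry β (lastRow c) i

theorem maxTableau_mem_rowBoundSet (hlam : Antitone lam) (hβ : IsUpper β) :
    maxTableau lam β ∈ rowBoundSet lam β := by
  refine ⟨⟨fun i c c' hcc => ?_, fun i i' c hc hc' hii => ?_⟩, fun i c => ?_⟩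
  · refine keyEntry_antitone hβ (le_lastRow hlam c') ((le_lastRow_iff hlam).2 ?_)
    exact (Fin.le_def.1 hcc).trans_lt ((le_lastRow_iff hlam).1 le_rfl)
  · exact strictMonoOn_keyEntry hβ _ (le_lastRow hlam ⟨c, hc⟩)
      ((le_lastRow_iff hlam).2 hc') hii
  · exact keyEntry_le hβ le_rfl (le_lastRow hlam c)

theorem le_maxTableau (hlam : Antitone lam) (hβ : IsUpper β) {T : Filling lam}
    (hT : T ∈ rowBoundSet lam β) : T ≤ maxTableau lam β := by
  intro i c
  obtain ⟨k, hik, hk, heq⟩ := exists_excess_eq_excess_keyEntry hβ (le_lastRow hlam c)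
  have hc := (le_lastRow_iff hlam).1 hk
  have hcol : (T i c : ℕ) + k ≤ T k ⟨c, hc⟩ + i := hT.1.add_le_add hlam hik c.isLt hc
  have hbound := hT.2 k ⟨c, hc⟩
  change T i c ≤ keyEntry β (lastRow c) i
  unfold excess at heq
  omega

theorem content_maxTableau_eq (hlam : Antitone lam) (hβ : IsUpper β) (hβ' : IsUpper β')
    (h : rowBoundSum lam β = rowBoundSum lam β') :
    content (maxTableau lam β) = content (maxTableau lam β') := by
  have hexists {β β' : Fin n → Fin n} (hβ : IsUpper β)
      (h : rowBoundSum lam β = rowBoundSum lam β') :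
      ∃ T ∈ rowBoundSet lam β', content T = content (maxTableau lam β) := by
    rw [← coeff_rowBoundSum_ne_zero, ← h, coeff_rowBoundSum_ne_zero]
    exact ⟨_, maxTableau_mem_rowBoundSet hlam hβ, rfl⟩
  obtain ⟨T, hT, hcontent⟩ := hexists hβ h
  obtain ⟨T', hT', hcontent'⟩ := hexists hβ' h.symm
  have hle : Finsupp.weight _ (content T') ≤ Finsupp.weight _ (content (maxTableau lam β)) :=
    strictMono_weight_content.monotone (le_maxTableau hlam hβ hT')
  rw [hcontent', ← hcontent] at hle
  have heq : T = maxTableau lam β' := (le_maxTableau hlam hβ' hT).eq_of_not_lt fun hlt =>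
    (strictMono_weight_content hlt).not_ge hle
  rw [← hcontent, heq]

theorem mem_columnsWith_maxTableau (hlam : Antitone lam) (c : Fin (lam i)) {v : Fin n} :
    (c : ℕ) ∈ columnsWith (maxTableau lam β) v ↔ v ∈ keySet β (lastRow c) := by
  constructor
  · rintro ⟨⟨k, c', hc'⟩, hk, rfl⟩
    exact ⟨k, (le_lastRow_iff hlam).2 hc', hk⟩
  · rintro ⟨k, hk, hkv⟩
    exact ⟨⟨k, c, (le_lastRow_iff hlam).1 hk⟩, hkv, rfl⟩

theorem IsGaplessCore.isLowerSet_columnsWith_maxTableau (hlam : Antitone lam)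
    (h : IsGaplessCore (dividers lam) β) (v : Fin n) :
    IsLowerSet (columnsWith (maxTableau lam β) v) := by
  intro c b hbc hc
  obtain ⟨⟨i, c, hci⟩, hi, rfl⟩ := hc
  have hbi : b < lam i := hbc.trans_lt hci
  have hle : lastRow (⟨c, hci⟩ : Fin (lam i)) ≤ lastRow (⟨b, hbi⟩ : Fin (lam i)) :=
    (le_lastRow_iff hlam).2 (hbc.trans_lt ((le_lastRow_iff hlam).1 le_rfl))
  rw [mem_columnsWith_maxTableau hlam ⟨b, hbi⟩]
  exact h.keySet_subset (isCarrelEnd_lastRow hlam _) (isCarrelEnd_lastRow hlam _) hle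
    ((mem_columnsWith_maxTableau hlam ⟨c, hci⟩).1 ⟨_, hi, rfl⟩)

theorem IsGaplessCore.columnsWith_maxTableau_eq (hlam : Antitone lam)
    (hβ : IsGaplessCore (dividers lam) β) (hβ' : IsGaplessCore (dividers lam) β')
    (h : rowBoundSum lam β = rowBoundSum lam β') (v : Fin n) :
    columnsWith (maxTableau lam β) v = columnsWith (maxTableau lam β') v := by
  have hcard : (columnsWith (maxTableau lam β) v).ncard =
      (columnsWith (maxTableau lam β') v).ncard := by
    rw [(maxTableau_mem_rowBoundSet hlam hβ.1).1.ncard_columnsWith,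
      (maxTableau_mem_rowBoundSet hlam hβ'.1).1.ncard_columnsWith,
      content_maxTableau_eq hlam hβ.1 hβ'.1 h]
  rcases (hβ.isLowerSet_columnsWith_maxTableau hlam v).total
    (hβ'.isLowerSet_columnsWith_maxTableau hlam v) with hsub | hsub
  · exact Set.eq_of_subset_of_ncard_le hsub hcard.ge ((Set.toFinite _).image _)
  · exact (Set.eq_of_subset_of_ncard_le hsub hcard.le ((Set.toFinite _).image _)).symm

theorem IsGapless.eq_of_rowBoundSum_eq (hlam : Antitone lam) (hβ : IsGapless (dividers lam) β)
    (hβ' : IsGapless (dividers lam) β') (h : rowBoundSum lam β = rowBoundSum lam β') : β = β' := by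
  refine hβ.eq_of_keySet_eq hβ' fun x hx => ?_
  rcases hx with ⟨-, c, ⟨i, hc⟩, hxc⟩ | hxn
  · obtain rfl : lastRow (⟨c, hc⟩ : Fin (lam i)) = x :=
      Fin.ext (Nat.succ_injective ((lastRow_add_one hlam ⟨c, hc⟩).trans hxc.symm))
    ext v
    rw [← mem_columnsWith_maxTableau hlam, ← mem_columnsWith_maxTableau hlam,
      hβ.1.columnsWith_maxTableau_eq hlam hβ'.1 h]
  · have huniv {β : Fin n → Fin n} (hβ : IsUpper β) : keySet β x = Set.univ := by
      rw [Set.eq_univ_iff_ncard, ncard_keySet hβ, hxn, Nat.card_fin]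
    rw [huniv hβ.1.1, huniv hβ'.1.1]

end MaxTableau

theorem attainsMaxEfficiency_iff {lam : Fin n → ℕ} (hlam : Antitone lam) {η : Fin n → Fin n} :
    AttainsMaxEfficiency lam η ↔ IsGapless (dividers lam) η := by
  constructor
  · rintro ⟨⟨hg, hb⟩, hmin⟩
    have hcore := hg.isGapless_core
    suffices h : core (dividers lam) η = η by rwa [h] at hcore
    by_contra hne
    refine (hmin _ hcore.1 hcore.isBoundedByPlatform hne ?_).not_ge
      (monomialCount_mono (core_le hg.1))
    rw [det_gvMatrix_eq_rowBoundSum hlam hcore.1 hcore.isBoundedByPlatform,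
      rowBoundSum_core hlam hb]
  · refine fun h => ⟨⟨h.1, h.isBoundedByPlatform⟩, fun η' hg hb hne hdet => ?_⟩
    rw [det_gvMatrix_eq_rowBoundSum hlam hg hb, ← rowBoundSum_core hlam hb] at hdet
    have hcore : core (dividers lam) η' = η := hg.isGapless_core.eq_of_rowBoundSum_eq hlam h hdet
    exact monomialCount_lt h.1.1 ((hcore ▸ core_le hg.1).lt_of_ne hne.symm)

end GVInput

theorem corollary8p4 (n : ℕ) (hn : 1 ≤ n) (lam : Fin n → ℕ) (hlam : Antitone lam) :
    {η : Fin n → Fin n | GVInput.IsValidInput lam η ∧ GVInput.AttainsMaxEfficiency lam η}.ncard =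
      GVInput.parabolicCatalan n (GVInput.dividers lam) := by
  rw [← GVInput.ncard_isGapless (GVInput.dividers lam)]
  congr 1
  ext η
  rw [Set.mem_ofPred_eq, Set.mem_ofPred_eq, GVInput.attainsMaxEfficiency_iff hlam]
  exact ⟨fun h => h.2, fun h =>
    ⟨⟨h.1.1, GVInput.nonpermutable hlam h.1 h.isBoundedByPlatform⟩, h⟩⟩
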